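/- Let $X$ be a diffeological space, let $G$ be an abelian diffeological group (written additively), and let $\mathcal Q$ be a generating family of $X$, i.e. a set of plots $q\colon U_q\to X$, with each $U_q$ open in some $\mathbb R^n$, such that every plot $p$ of $X$, restricted to the members of some open cover of its domain, factors smoothly through plots in $\mathcal Q$. Suppose that the domain $U_q$ of every $q\in\mathcal Q$ is contractible. Let $\mathcal N(\mathcal Q)=\coprod_{q\in\mathcal Q}U_q$ be the nebula (with the sum diffeology), let $\mathrm{ev}\colon\mathcal N(\mathcal Q)\to X$ be the map $u\in U_q\mapsto q(u)$, and let $\mathcal N(\mathcal Q)_k$ be the $(k+1)$-fold fibered product of $\mathcal N(\mathcal Q)$ over $X$. Let $\check H^k(\mathcal Q,G)$ be the cohomology of the complex of the groups $C^\infty(\mathcal N(\mathcal Q)_k,G)$ of smooth maps (pointwise addition), with $\partial f=\sum_{i=0}^{k+1}(-1)^i f\circ d_i$, where $d_i$ drops the $i$-th entry. A refinement $\mathcal R$ of $\mathcal Q$ is a generating family with a map of index sets $r\mapsto q_r$ and smooth maps $f_r\colon U_r\to U_{q_r}$ such that $q_r\circ f_r=r$ for all $r\in\mathcal R$; it induces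 a homomorphism $\check H^k(\mathcal Q,G)\to\check H^k(\mathcal R,G)$, and $\check H^k(X,G)$ is the colimit of the groups $\check H^k(\mathcal Q,G)$ over all generating families and refinements. Let $R(\mathrm{ev})$ be the diffeological groupoid $\mathcal N(\mathcal Q)\times_X\mathcal N(\mathcal Q)\rightrightarrows\mathcal N(\mathcal Q)$ with source $(y_1,y_2)\mapsto y_2$, target $(y_1,y_2)\mapsto y_1$ and multiplication $(y_1,y_2)(y_2,y_3)=(y_1,y_3)$. Then: 1. The canonical homomorphism $\check H^1(\mathcal Q,G)\to\check H^1(X,G)$ is bijective. 2. There is a bijection between $\check H^1(X,G)$ and the set of smooth actions of $R(\mathrm{ev})$ on $\mathcal N(\mathcal Q)\times G$ that have the projection to $\mathcal N(\mathcal Q)$ as anchor map and commute with right translation by $G$, taken up to $(R(\mathrm{ev})\text{-}G)$-equivariant isomorphism (diffeomorphisms of $\mathcal N(\mathcal Q)\times G$ equivariant for both the groupoid actions and right translation by $G$). It sends the class represented by a $1$-cocycle $f\colon\mathcal N(\mathcal Q)_1\to G$ to the class of the action $(y_1,y_2)\cdot(y_2,g)=(y_1,f(y_1,y_2)+g)$.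 -/

import Mathlib

namespace DiffCech

open Diffeology TopologicalSpace
open scoped ContDiff DirectSum

noncomputable section

universe u v w

/-! ### Subset, product and sum diffeologies, diffeological groups

Diffeological spaces and their smooth maps are Mathlib's `DiffeologicalSpace` and `DSmooth`. -/

section Constructions

/-- The subset diffeology: the plots are the plots of `X` with values in the subset. -/
instance subtypeDiffeology {X : Type u} [DiffeologicalSpace X] (P : X → Prop) :
    DiffeologicalSpace {x : X // P x} where
  plots _ := {p | IsPlot fun x => (p x : X)}
  constant_plots _ := isPlot_const
  plot_reparam hp hf := isPlot_reparam hp hf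
  locality hp := DiffeologicalSpace.locality hp

/-- The product diffeology on an indexed product. -/
instance piDiffeology {ι : Type u} (X : ι → Type v) [∀ i, DiffeologicalSpace (X i)] :
    DiffeologicalSpace (∀ i, X i) where
  plots _ := {p | ∀ i, IsPlot fun x => p x i}
  constant_plots _ := fun _ => isPlot_const
  plot_reparam hp hf := fun i => isPlot_reparam (hp i) hf
  locality hp := fun i => DiffeologicalSpace.locality fun x =>
    let ⟨u, hu, hxu, h⟩ := hp x
    ⟨u, hu, hxu, fun hf hf' => h hf hf' i⟩

/-- The product diffeology on a product of two spaces. -/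
instance prodDiffeology (X : Type u) (Y : Type v) [DiffeologicalSpace X]
    [DiffeologicalSpace Y] : DiffeologicalSpace (X × Y) where
  plots _ := {p | (IsPlot fun x => (p x).1) ∧ IsPlot fun x => (p x).2}
  constant_plots _ := ⟨isPlot_const, isPlot_const⟩
  plot_reparam hp hf := ⟨isPlot_reparam hp.1 hf, isPlot_reparam hp.2 hf⟩
  locality hp :=
    ⟨DiffeologicalSpace.locality fun x =>
      let ⟨u, hu, hxu, h⟩ := hp x
      ⟨u, hu, hxu, fun hf hf' => (h hf hf').1⟩,
     DiffeologicalSpace.locality fun x =>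
      let ⟨u, hu, hxu, h⟩ := hp x
      ⟨u, hu, hxu, fun hf hf' => (h hf hf').2⟩⟩

/-- The sum diffeology: a parametrization is a plot if, locally around each point of its domain,
it is a plot `q : V → X i` of one of the summands followed by the inclusion of that summand.
(A plot defined on an open set `V` is a smooth map out of `V`.) -/
instance sigmaDiffeology {ι : Type u} (X : ι → Type v) [∀ i, DiffeologicalSpace (X i)] :
    DiffeologicalSpace (Σ i, X i) where
  plots n := {p | ∀ x, ∃ V : Opens (EuclideanSpace ℝ (Fin n)), x ∈ V ∧
    ∃ (i : ι) (q : V → X i), DSmooth q ∧ ∀ y : V, p y = ⟨i, q y⟩}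
  constant_plots a := fun _ => ⟨⊤, trivial, a.1, fun _ => a.2, dSmooth_const, fun _ => rfl⟩
  plot_reparam {n m p f} hp hf := fun x => by
    obtain ⟨V, hxV, i, q, hq, h⟩ := hp (f x)
    refine ⟨⟨f ⁻¹' V, V.2.preimage hf.continuous⟩, hxV, i, fun y => q ⟨f y, y.2⟩, ?_,
      fun y => h ⟨f y, y.2⟩⟩
    intro k r hr
    exact hq k (fun z => ⟨f (r z), (r z).2⟩) (hf.comp (IsPlot.contDiff (X := EuclideanSpace ℝ (Fin n)) hr)).isPlot
  locality {n p} hp := fun x => by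
    obtain ⟨u, hu, hxu, h⟩ := hp x
    obtain ⟨ε, hε, hε'⟩ := Metric.isOpen_iff.mp hu x hxu
    have hmem : ∀ z, OpenPartialHomeomorph.univBall x ε z ∈ Metric.ball x ε := fun z => by
      have := (OpenPartialHomeomorph.univBall x ε).map_source (x := z) (by simp)
      rwa [OpenPartialHomeomorph.univBall_target x hε] at this
    obtain ⟨V, hV0, i, q, hq, hqp⟩ := h (f := OpenPartialHomeomorph.univBall x ε)
      (fun z => hε' (hmem z)) OpenPartialHomeomorph.contDiff_univBall 0
    have hsymm := OpenPartialHomeomorph.contDiffOn_univBall_symm (n := (⊤ : ℕ∞)) (c := x) (r := ε)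
    let W : Opens (EuclideanSpace ℝ (Fin n)) :=
      ⟨Metric.ball x ε ∩ (OpenPartialHomeomorph.univBall x ε).symm ⁻¹' V,
        hsymm.continuousOn.isOpen_inter_preimage Metric.isOpen_ball V.2⟩
    refine ⟨W, ⟨Metric.mem_ball_self hε, ?_⟩, i,
      fun y => q ⟨(OpenPartialHomeomorph.univBall x ε).symm y, y.2.2⟩, ?_, fun y => ?_⟩
    · simpa [OpenPartialHomeomorph.univBall_symm_apply_center] using hV0
    · intro k r hr
      exact hq k (fun z => ⟨(OpenPartialHomeomorph.univBall x ε).symm (r z), (r z).2.2⟩)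
        (contDiffOn_univ.1 (hsymm.comp
          (IsPlot.contDiff (X := EuclideanSpace ℝ (Fin n)) hr).contDiffOn
          fun z _ => (r z).2.1)).isPlot
    · have := hqp ⟨(OpenPartialHomeomorph.univBall x ε).symm y, y.2.2⟩
      rw [← this]
      simp only [Function.comp_apply]
      rw [OpenPartialHomeomorph.right_inv]
      rw [OpenPartialHomeomorph.univBall_target x hε]
      exact y.2.1

end Constructions

/-- An (additively written, abelian) diffeological group: addition and negation are smooth. -/
class AbelianDiffeologicalGroup (G : Type u) [AddCommGroup G] [DiffeologicalSpace G] : Prop where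
  smooth_add : DSmooth fun p : G × G => p.1 + p.2
  smooth_neg : DSmooth fun g : G => -g

/-- The group of smooth maps from `Y` to `G`, with the pointwise operations. -/
def smoothMaps (Y : Type u) [DiffeologicalSpace Y] (G : Type v) [AddCommGroup G]
    [DiffeologicalSpace G] [AbelianDiffeologicalGroup G] : AddSubgroup (Y → G) where
  carrier := {f | DSmooth f}
  add_mem' {f g} hf hg := fun n p hp =>
    AbelianDiffeologicalGroup.smooth_add n (fun x => (f (p x), g (p x))) ⟨hf n p hp, hg n p hp⟩
  zero_mem' := dSmooth_const (y := (0 : G))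
  neg_mem' {f} hf := AbelianDiffeologicalGroup.smooth_neg.comp (f := f) hf

/-- Precomposition with a smooth map. -/
def precomp {Y : Type u} {Z : Type w} [DiffeologicalSpace Y] [DiffeologicalSpace Z] (G : Type v)
    [AddCommGroup G] [DiffeologicalSpace G] [AbelianDiffeologicalGroup G]
    (φ : Y → Z) (hφ : DSmooth φ) : smoothMaps Z G →+ smoothMaps Y G where
  toFun f := ⟨fun y => f.1 (φ y), DSmooth.comp (g := f.1) f.2 hφ⟩
  map_zero' := rfl
  map_add' _ _ := rfl

/-! ### Plots on Euclidean open sets, generating families, nebulae -/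

/-- A plot of `X` defined on an open subset of a Euclidean space. -/
structure Plot (X : Type u) [DiffeologicalSpace X] where
  /-- the dimension of the Euclidean space -/
  dim : ℕ
  /-- the domain of the plot -/
  domain : Opens (EuclideanSpace ℝ (Fin dim))
  /-- the underlying parametrization -/
  toFun : domain → X
  smooth : DSmooth toFun

/-- A (covering) generating family of `X`: a set of plots such that every plot of `X`, restricted
to the members of some open cover of its domain, factors smoothly through plots of the set. -/
structure GeneratingFamily (X : Type u) [DiffeologicalSpace X] where
  /-- the plots belonging to the family -/
  plots : Set (Plot X)
  generating : ∀ (p : Plot X) (x : p.domain),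
    ∃ (V : Opens (EuclideanSpace ℝ (Fin p.dim))) (hV : V ≤ p.domain), x.1 ∈ V ∧
      ∃ q ∈ plots, ∃ f : V → q.domain, DSmooth f ∧
        ∀ y : V, p.toFun ⟨y, hV y.2⟩ = q.toFun (f y)

variable {X : Type u} [DiffeologicalSpace X]

/-- The nebula of a generating family: the sum of the domains of its plots. -/
abbrev Nebula (Q : GeneratingFamily X) : Type u := Σ q : Q.plots, q.1.domain

/-- The evaluation map of the nebula. -/
def ev (Q : GeneratingFamily X) (y : Nebula Q) : X := y.1.1.toFun y.2

/-- The fiber product `N(Q)_k` of `k + 1` copies of the nebula over `X`. -/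
abbrev NebulaPower (Q : GeneratingFamily X) (k : ℕ) : Type u :=
  {x : Fin (k + 1) → Nebula Q // ∀ i j, ev Q (x i) = ev Q (x j)}

/-- The pair `(y₁, y₂)` as an element of `N(Q)_1`. -/
def NebulaPower.pair {Q : GeneratingFamily X} (y₁ y₂ : Nebula Q) (h : ev Q y₁ = ev Q y₂) :
    NebulaPower Q 1 :=
  ⟨![y₁, y₂], by
    intro i j
    fin_cases i <;> fin_cases j <;> simp [h]⟩

/-- The map `d_i : N(Q)_{k+1} → N(Q)_k` dropping the `i`-th entry. -/
def face (Q : GeneratingFamily X) (k : ℕ) (i : Fin (k + 2)) (x : NebulaPower Q (k + 1)) :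
    NebulaPower Q k :=
  ⟨fun j => x.1 (i.succAbove j), fun _ _ => x.2 _ _⟩

theorem smooth_face (Q : GeneratingFamily X) (k : ℕ) (i : Fin (k + 2)) :
    DSmooth (face Q k i) :=
  fun _ _ hp j => hp (i.succAbove j)

/-! ### Čech cohomology of a generating family with values in `G` -/

section Cohomology

variable (Q R : GeneratingFamily X) (G : Type v) [AddCommGroup G] [DiffeologicalSpace G]
  [AbelianDiffeologicalGroup G] (k : ℕ)

/-- Degree `k` Čech cochains of the sheaf of smooth `G`-valued maps: smooth maps `N(Q)_k → G`. -/
abbrev Cochains : Type (max u v) := smoothMaps (NebulaPower Q k) G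

/-- The coboundary `∂ f = ∑ i, (-1)^i f ∘ d_i`. -/
def coboundary : Cochains Q G k →+ Cochains Q G (k + 1) :=
  ∑ i : Fin (k + 2), ((-1 : ℤ) ^ (i : ℕ)) • precomp G (face Q k i) (smooth_face Q k i)

/-- The group of Čech cocycles. -/
def cocycles : AddSubgroup (Cochains Q G k) := (coboundary Q G k).ker

/-- The group of Čech coboundaries. -/
def coboundaries : (k : ℕ) → AddSubgroup (Cochains Q G k)
  | 0 => ⊥
  | k + 1 => (coboundary Q G k).range

/-- The Čech cohomology group of degree `k` associated to the generating family `Q`. -/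
abbrev FamilyCohomology : Type (max u v) :=
  cocycles Q G k ⧸ (coboundaries Q G k).addSubgroupOf (cocycles Q G k)

/-- A refinement `R` of `Q`: every plot of `R` factors smoothly through an assigned plot of `Q`. -/
structure Refinement where
  /-- the map of index sets -/
  index : R.plots → Q.plots
  /-- the smooth maps between the domains -/
  map : ∀ r : R.plots, r.1.domain → (index r).1.domain
  smooth : ∀ r, DSmooth (map r)
  comm : ∀ (r : R.plots) (x : r.1.domain), (index r).1.toFun (map r x) = r.1.toFun x

namespace Refinement

variable {Q R} (φ : Refinement Q R)

/-- The map of nebulae induced by a refinement. -/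
def nebulaMap (y : Nebula R) : Nebula Q := ⟨φ.index y.1, φ.map y.1 y.2⟩

theorem ev_nebulaMap (y : Nebula R) : ev Q (φ.nebulaMap y) = ev R y := φ.comm y.1 y.2

theorem smooth_nebulaMap : DSmooth φ.nebulaMap := fun n p hp x => by
  obtain ⟨V, hxV, i, q, hq, h⟩ := hp x
  exact ⟨V, hxV, φ.index i, fun y => φ.map i (q y), (φ.smooth i).comp hq, fun y => by
    simp only [Function.comp_apply]
    rw [h y]
    rfl⟩

/-- The induced map `N(R)_k → N(Q)_k`. -/
def powerMap (x : NebulaPower R k) : NebulaPower Q k :=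
  ⟨fun i => φ.nebulaMap (x.1 i), fun i j => by
    rw [ev_nebulaMap, ev_nebulaMap]; exact x.2 i j⟩

theorem smooth_powerMap : DSmooth (φ.powerMap k) :=
  fun n _ hp i => φ.smooth_nebulaMap n _ (hp i)

/-- The induced map on cochains. -/
def cochainMap : Cochains Q G k →+ Cochains R G k := precomp G (φ.powerMap k) (φ.smooth_powerMap k)

theorem cochainMap_coboundary (f : Cochains Q G k) :
    coboundary R G k (φ.cochainMap G k f) = φ.cochainMap G (k + 1) (coboundary Q G k f) := by
  simp only [coboundary, AddMonoidHom.finsetSum_apply, map_sum, AddMonoidHom.smul_apply, map_zsmul]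
  rfl

/-- The induced map on cocycles. -/
def cocycleMap : cocycles Q G k →+ cocycles R G k :=
  ((φ.cochainMap G k).comp (cocycles Q G k).subtype).codRestrict (cocycles R G k) fun f => by
    have hf : coboundary Q G k f.1 = 0 := f.2
    change coboundary R G k (φ.cochainMap G k f.1) = 0
    rw [cochainMap_coboundary, hf, map_zero]

/-- The map on cohomology induced by a refinement. -/
def cohomologyMap : FamilyCohomology Q G k →+ FamilyCohomology R G k :=
  QuotientAddGroup.map _ _ (φ.cocycleMap G k) fun f hf => by
    change φ.cochainMap G k f.1 ∈ coboundaries R G k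
    replace hf : f.1 ∈ coboundaries Q G k := hf
    cases k with
    | zero =>
      have h0 : f.1 = 0 := hf
      rw [h0, map_zero]
      exact zero_mem _
    | succ k =>
      obtain ⟨g, hg⟩ := hf
      exact ⟨φ.cochainMap G k g, by rw [cochainMap_coboundary, hg]⟩

end Refinement

variable (X)

open Classical in
/-- The relations defining the colimit: a class is identified with its image under the map induced
by any refinement. -/
def colimitRelations :
    AddSubgroup (⨁ Q : GeneratingFamily X, FamilyCohomology Q G k) :=
  AddSubgroup.closure {z | ∃ (Q R : GeneratingFamily X) (φ : Refinement Q R)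
    (a : FamilyCohomology Q G k),
    z = DirectSum.of (fun Q => FamilyCohomology Q G k) R (φ.cohomologyMap G k a) -
      DirectSum.of (fun Q => FamilyCohomology Q G k) Q a}

/-- The Čech cohomology group of `X` with values in `G`: the colimit (in abelian groups) of the
groups `FamilyCohomology Q G k` over all generating families `Q` and all refinements. -/
abbrev CechCohomology : Type (max u v) :=
  (⨁ Q : GeneratingFamily X, FamilyCohomology Q G k) ⧸ colimitRelations X G k

variable {X}

open Classical in
/-- The canonical homomorphism from the cohomology of a generating family to the colimit. -/
def toCech : FamilyCohomology Q G k →+ CechCohomology X G k :=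
  (QuotientAddGroup.mk' (colimitRelations X G k)).comp
    (DirectSum.of (fun Q => FamilyCohomology Q G k) Q)

end Cohomology

/-! ### Diffeological groupoids and their actions -/

/-- A diffeological groupoid with arrow space `H₁` and object space `H₀`; `mul (g, h)` is defined
when the source of `g` is the target of `h`. -/
structure DiffeologicalGroupoid (H₁ : Type u) (H₀ : Type v) [DiffeologicalSpace H₁]
    [DiffeologicalSpace H₀] where
  src : H₁ → H₀
  tgt : H₁ → H₀
  unit : H₀ → H₁
  inv : H₁ → H₁
  mul : {p : H₁ × H₁ // src p.1 = tgt p.2} → H₁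
  smooth_src : DSmooth src
  smooth_tgt : DSmooth tgt
  smooth_unit : DSmooth unit
  smooth_inv : DSmooth inv
  smooth_mul : DSmooth mul
  src_unit : ∀ y, src (unit y) = y
  tgt_unit : ∀ y, tgt (unit y) = y
  src_inv : ∀ h, src (inv h) = tgt h
  tgt_inv : ∀ h, tgt (inv h) = src h
  src_mul : ∀ p, src (mul p) = src p.1.2
  tgt_mul : ∀ p, tgt (mul p) = tgt p.1.1
  mul_assoc : ∀ (g h k : H₁) (hgh : src g = tgt h) (hhk : src h = tgt k),
    mul ⟨(mul ⟨(g, h), hgh⟩, k), (src_mul _).trans hhk⟩ =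
      mul ⟨(g, mul ⟨(h, k), hhk⟩), hgh.trans (tgt_mul ⟨(h, k), hhk⟩).symm⟩
  unit_mul : ∀ h, mul ⟨(unit (tgt h), h), src_unit _⟩ = h
  mul_unit : ∀ h, mul ⟨(h, unit (src h)), (tgt_unit _).symm⟩ = h
  inv_mul : ∀ h, mul ⟨(inv h, h), src_inv h⟩ = unit (src h)
  mul_inv : ∀ h, mul ⟨(h, inv h), (tgt_inv h).symm⟩ = unit (tgt h)

/-- The groupoid `R(π)` of a map `π : Y → X`: the arrows are the pairs `(y₁, y₂)` in `Y ×_X Y`,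
with source `y₂` and target `y₁`, and `(y₁, y₂)(y₂, y₃) = (y₁, y₃)`. -/
def relationGroupoid {Y : Type w} [DiffeologicalSpace Y] (π : Y → X) :
    DiffeologicalGroupoid {r : Y × Y // π r.1 = π r.2} Y where
  src r := r.1.2
  tgt r := r.1.1
  unit y := ⟨(y, y), rfl⟩
  inv r := ⟨(r.1.2, r.1.1), r.2.symm⟩
  mul p := ⟨(p.1.1.1.1, p.1.2.1.2), p.1.1.2.trans ((congrArg π p.2).trans p.1.2.2)⟩
  smooth_src := fun _ _ hp => hp.2
  smooth_tgt := fun _ _ hp => hp.1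
  smooth_unit := fun _ _ hp => ⟨hp, hp⟩
  smooth_inv := fun _ _ hp => ⟨hp.2, hp.1⟩
  smooth_mul := fun _ _ hp => ⟨hp.1.1, hp.2.2⟩
  src_unit _ := rfl
  tgt_unit _ := rfl
  src_inv _ := rfl
  tgt_inv _ := rfl
  src_mul _ := rfl
  tgt_mul _ := rfl
  mul_assoc _ _ _ _ _ := rfl
  unit_mul _ := rfl
  mul_unit _ := rfl
  inv_mul _ := rfl
  mul_inv _ := rfl

section Actions

variable {H₁ : Type u} {H₀ : Type v} [DiffeologicalSpace H₁] [DiffeologicalSpace H₀]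

/-- A smooth (left) action of the groupoid `H` on `Z` with anchor map `ρ`. -/
structure GroupoidAction (H : DiffeologicalGroupoid H₁ H₀) {Z : Type w} [DiffeologicalSpace Z]
    (ρ : Z → H₀) where
  act : {p : H₁ × Z // H.src p.1 = ρ p.2} → Z
  smooth_anchor : DSmooth ρ
  smooth_act : DSmooth act
  anchor_act : ∀ p, ρ (act p) = H.tgt p.1.1
  mul_act : ∀ (g h : H₁) (z : Z) (hgh : H.src g = H.tgt h) (hz : H.src h = ρ z),
    act ⟨(g, act ⟨(h, z), hz⟩), hgh.trans (anchor_act ⟨(h, z), hz⟩).symm⟩ =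
      act ⟨(H.mul ⟨(g, h), hgh⟩, z), (H.src_mul _).trans hz⟩
  unit_act : ∀ z, act ⟨(H.unit (ρ z), z), H.src_unit _⟩ = z

/-- Equivariant maps between two spaces acted on by the same groupoid. -/
structure IsEquivariant {H : DiffeologicalGroupoid H₁ H₀} {Z Z' : Type w} [DiffeologicalSpace Z]
    [DiffeologicalSpace Z'] {ρ : Z → H₀} {ρ' : Z' → H₀} (A : GroupoidAction H ρ)
    (B : GroupoidAction H ρ') (Φ : Z → Z') : Prop where
  smooth : DSmooth Φ
  anchor : ∀ z, ρ' (Φ z) = ρ z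
  map_act : ∀ (h : H₁) (z : Z) (hz : H.src h = ρ z),
    Φ (A.act ⟨(h, z), hz⟩) = B.act ⟨(h, Φ z), hz.trans (anchor z).symm⟩

end Actions

section NebulaActions

variable (Q : GeneratingFamily X) (G : Type v) [AddCommGroup G] [DiffeologicalSpace G]

/-- Right translation by `a` on `N(Q) × G`. -/
def translate {Q : GeneratingFamily X} {G : Type v} [AddCommGroup G] (z : Nebula Q × G) (a : G) :
    Nebula Q × G := (z.1, z.2 + a)

/-- The actions of `R(ev : N(Q) → X)` on `N(Q) × G`, with anchor map the projection to `N(Q)`,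
that commute with right translation by `G`. -/
structure NebulaAction extends GroupoidAction (relationGroupoid (ev Q))
    (Prod.fst : Nebula Q × G → Nebula Q) where
  act_translate : ∀ (r : {r : Nebula Q × Nebula Q // ev Q r.1 = ev Q r.2}) (z : Nebula Q × G)
    (hz : (relationGroupoid (ev Q)).src r = z.1) (a : G),
    act ⟨(r, translate z a), hz⟩ = translate (act ⟨(r, z), hz⟩) a

/-- `(R(ev)-G)`-equivariant isomorphism of two such actions: the existence of a diffeomorphism of
`N(Q) × G` equivariant for the groupoid actions and for right translation. -/
instance nebulaActionSetoid : Setoid (NebulaAction Q G) where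
  r A B := ∃ Φ : Nebula Q × G ≃ Nebula Q × G,
    IsEquivariant A.toGroupoidAction B.toGroupoidAction Φ ∧ DSmooth Φ.symm ∧
      ∀ z a, Φ (translate z a) = translate (Φ z) a
  iseqv := by
    refine ⟨fun A => ⟨Equiv.refl _, ⟨dSmooth_id, fun _ => rfl, fun _ _ _ => rfl⟩, dSmooth_id,
      fun _ _ => rfl⟩, ?_, ?_⟩
    · rintro A B ⟨Φ, h, h', h''⟩
      have han : ∀ z, (Φ.symm z).1 = z.1 := fun z => by
        simpa using (h.anchor (Φ.symm z)).symm
      refine ⟨Φ.symm, ⟨h', han, fun r z hz => ?_⟩, h.smooth, fun z a => ?_⟩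
      · rw [Equiv.symm_apply_eq, h.map_act]
        simp
      · rw [Equiv.symm_apply_eq, h'']
        simp
    · rintro A B C ⟨Φ, h, h', h''⟩ ⟨Ψ, k, k', k''⟩
      refine ⟨Φ.trans Ψ, ⟨k.smooth.comp h.smooth, fun z => (k.anchor _).trans (h.anchor z),
        fun r z hz => ?_⟩, h'.comp k', fun z a => ?_⟩
      · simp [h.map_act, k.map_act]
      · simp [h'', k'']

/-- The set of such actions up to `(R(ev)-G)`-equivariant isomorphism. -/
abbrev NebulaActionClasses : Type (max u v) := Quotient (nebulaActionSetoid Q G)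

end NebulaActions

end

end DiffCech

/-!
A `1`-cocycle on the nebula of a generating family is gluing data for a principal `G`-bundle over
`X`. The key fact is that the pullback of such a bundle along a plot with contractible domain has a
smooth section. Indeed, triviality is preserved by smooth homotopies: a section is carried from one
end of the homotopy to the other by small steps cut off by a partition of unity, and it extends
over a small step because sections exist locally and differ by a `G`-valued function. This is
applied to a smooth contraction of the domain.

Let a bundle be given by a cocycle of an arbitrary generating family `R`. Its sections over the
members of `Q` differ on the fiber product by functions which, by descent along the evaluation map,
form a cocycle of `Q` defining an isomorphic bundle; this cocycle is unique up to a coboundary. In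
this way the cohomology of every `R` maps to that of `Q`, compatibly with refinements, and the
resulting map out of the colimit inverts the canonical homomorphism.

An action `A` of `R(ev)` that commutes with translations is determined by the cocycle `F` with
`(a, b) · (b, 0) = (a, F a b)`, and equivariant isomorphisms of actions are cochains of degree zero.
-/

namespace DiffCech

open Diffeology TopologicalSpace Set Function Filter
open scoped ContDiff DirectSum Topology

noncomputable section

/-! ### Smooth maps on subsets -/

section SmoothOn

variable {W X Y Z : Type*} [DiffeologicalSpace W] [DiffeologicalSpace X] [DiffeologicalSpace Y]
  [DiffeologicalSpace Z]

/-- Smoothness of `f` on `s` for the subset diffeology of `s`; the values of `f` outside of `s` are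
irrelevant, and `s` need not be open. -/
def DSmoothOn (f : Y → Z) (s : Set Y) : Prop :=
  ∀ ⦃n : ℕ⦄ ⦃p : EuclideanSpace ℝ (Fin n) → Y⦄, IsPlot p → (∀ r, p r ∈ s) →
    IsPlot fun r => f (p r)

theorem dSmoothOn_univ {f : Y → Z} : DSmoothOn f univ ↔ DSmooth f :=
  ⟨fun h _ _ hp => h hp fun _ => mem_univ _, fun h _ _ hp _ => h _ _ hp⟩

theorem dSmooth_fst : DSmooth (Prod.fst : Y × Z → Y) := fun _ _ hp => hp.1

theorem dSmooth_snd : DSmooth (Prod.snd : Y × Z → Z) := fun _ _ hp => hp.2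

theorem dSmoothOn_of_dSmooth {f : Y → Z} (h : DSmooth f) (s : Set Y) : DSmoothOn f s :=
  fun _ _ hp _ => h _ _ hp

namespace DSmoothOn

variable {f g : Y → Z} {s t : Set Y}

theorem mono (h : DSmoothOn f t) (hst : s ⊆ t) : DSmoothOn f s :=
  fun _ _ hp hs => h hp fun r => hst (hs r)

theorem congr (h : DSmoothOn f s) (hfg : EqOn g f s) : DSmoothOn g s := fun _ _ hp hs => by
  simpa only [fun r => hfg (hs r)] using h hp hs

theorem comp {h : Z → W} {t : Set Z} (hh : DSmoothOn h t) (hf : DSmoothOn f s)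
    (hst : MapsTo f s t) : DSmoothOn (fun y => h (f y)) s :=
  fun _ _ hp hs => hh (hf hp hs) fun r => hst (hs r)

theorem prodMk {h : Y → W} (hf : DSmoothOn f s) (hh : DSmoothOn h s) :
    DSmoothOn (fun y => (f y, h y)) s :=
  fun _ _ hp hs => ⟨hf hp hs, hh hp hs⟩

section Group

variable {G : Type*} [AddCommGroup G] [DiffeologicalSpace G] [AbelianDiffeologicalGroup G]
  {f g : Y → G}

theorem add (hf : DSmoothOn f s) (hg : DSmoothOn g s) : DSmoothOn (fun y => f y + g y) s :=
  fun _ _ hp hs =>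
    AbelianDiffeologicalGroup.smooth_add _ (fun _ => (f _, g _)) ⟨hf hp hs, hg hp hs⟩

theorem sub (hf : DSmoothOn f s) (hg : DSmoothOn g s) : DSmoothOn (fun y => f y - g y) s := by
  simpa only [sub_eq_add_neg] using
    hf.add fun _ _ hp hs => AbelianDiffeologicalGroup.smooth_neg _ _ (hg hp hs)

end Group

end DSmoothOn

/-- A topology for which plots are continuous, i.e. one that is coarser than the D-topology. -/
class ContinuousPlots (Y : Type*) [TopologicalSpace Y] [DiffeologicalSpace Y] : Prop where
  continuous_plot : ∀ {n : ℕ} {p : EuclideanSpace ℝ (Fin n) → Y}, IsPlot p → Continuous p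

instance [TopologicalSpace Y] [IsDTopologyCompatible Y] : ContinuousPlots Y :=
  ⟨fun hp => hp.dSmooth.continuous'⟩

instance [TopologicalSpace Y] [ContinuousPlots Y] (P : Y → Prop) : ContinuousPlots {y // P y} :=
  ⟨fun hp => (ContinuousPlots.continuous_plot (Y := Y) hp).subtype_mk _⟩

instance [TopologicalSpace Y] [TopologicalSpace Z] [ContinuousPlots Y] [ContinuousPlots Z] :
    ContinuousPlots (Y × Z) :=
  ⟨fun hp => (ContinuousPlots.continuous_plot hp.1).prodMk (ContinuousPlots.continuous_plot hp.2)⟩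

theorem DSmoothOn.of_locally [TopologicalSpace W] [ContinuousPlots W] {f : Y → Z} {s : Set Y}
    {g : Y → W} (hg : DSmoothOn g s)
    (h : ∀ y ∈ s, ∃ N ∈ 𝓝 (g y), DSmoothOn f (s ∩ g ⁻¹' N)) : DSmoothOn f s := by
  intro n p hp hs
  refine DiffeologicalSpace.locality fun r => ?_
  obtain ⟨N, hN, hfN⟩ := h (p r) (hs r)
  obtain ⟨O, hON, hO, hrO⟩ := mem_nhds_iff.1 hN
  exact ⟨_, hO.preimage (ContinuousPlots.continuous_plot (hg hp hs)), hrO, fun {m e} he hsmooth =>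
    hfN (isPlot_reparam hp hsmooth) fun z => ⟨hs _, hON (he z)⟩⟩

end SmoothOn

/-! ### Subductions -/

section Subduction

variable {W X Y Z : Type*} [DiffeologicalSpace W] [DiffeologicalSpace X] [DiffeologicalSpace Y]
  [DiffeologicalSpace Z]

/-- The part over `s` of the fiber product of `p : Z → X` and `π : Y → X`. -/
def fiberProd {X Y Z : Type*} (π : Y → X) (s : Set Z) (p : Z → X) : Set (Z × Y) :=
  {w | w.1 ∈ s ∧ π w.2 = p w.1}

/-- A subduction: a smooth map through which every plot of the target, defined on an open set of a
Euclidean space, factors smoothly locally. -/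
structure IsSubduction (π : Y → X) : Prop where
  smooth : DSmooth π
  exists_lift : ∀ {n : ℕ} {U : Opens (EuclideanSpace ℝ (Fin n))} {p : U → X}, DSmooth p →
    ∀ x : U, ∃ N ∈ 𝓝 x, ∃ a : U → Y, DSmoothOn a N ∧ ∀ r ∈ N, π (a r) = p r

namespace IsSubduction

variable {π : Y → X}

theorem surjective (hπ : IsSubduction π) : Surjective π := fun x => by
  obtain ⟨N, hN, a, -, ha⟩ := hπ.exists_lift (n := 0) (U := ⊤) (p := fun _ => x) dSmooth_const
    ⟨0, trivial⟩
  exact ⟨_, ha _ (mem_of_mem_nhds hN)⟩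

theorem exists_lift_plot (hπ : IsSubduction π) {n : ℕ} {p : EuclideanSpace ℝ (Fin n) → X}
    (hp : IsPlot p) (x : EuclideanSpace ℝ (Fin n)) :
    ∃ N ∈ 𝓝 x, ∃ a : EuclideanSpace ℝ (Fin n) → Y, DSmoothOn a N ∧ ∀ r ∈ N, π (a r) = p r := by
  have hcoe : DSmooth fun r : (⊤ : Opens (EuclideanSpace ℝ (Fin n))) => p r := fun _ _ hq =>
    isPlot_reparam hp (IsPlot.contDiff (X := EuclideanSpace ℝ (Fin n)) hq)
  obtain ⟨N, hN, a, hsmooth, ha⟩ := hπ.exists_lift hcoe ⟨x, trivial⟩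
  have hmk : Continuous fun r : EuclideanSpace ℝ (Fin n) =>
      (⟨r, trivial⟩ : (⊤ : Opens (EuclideanSpace ℝ (Fin n)))) := continuous_id.subtype_mk _
  exact ⟨_, hmk.continuousAt.preimage_mem_nhds hN, fun r => a ⟨r, trivial⟩,
    fun _ _ hq hs => hsmooth (p := fun r => ⟨_, trivial⟩) hq hs, fun r hr => ha _ hr⟩

theorem exists_descent (hπ : IsSubduction π) {s : Set Z} {p : Z → X} (hp : DSmoothOn p s)
    {K : Z → Y → W} (hK : DSmoothOn (fun w : Z × Y => K w.1 w.2) (fiberProd π s p))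
    (hconst : ∀ z ∈ s, ∀ a b, π a = p z → π b = p z → K z a = K z b) :
    ∃ k : Z → W, DSmoothOn k s ∧ ∀ z ∈ s, ∀ a, π a = p z → K z a = k z := by
  choose lift hlift using hπ.surjective
  have hk : ∀ z ∈ s, ∀ a, π a = p z → K z a = K z (lift (p z)) :=
    fun z hz a ha => hconst z hz _ _ ha (hlift _)
  refine ⟨fun z => K z (lift (p z)), fun n q hq hs => ?_, hk⟩
  refine DiffeologicalSpace.locality fun r => ?_
  obtain ⟨N, hN, a, hsmooth, ha⟩ := hπ.exists_lift_plot (hp hq hs) r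
  obtain ⟨O, hON, hO, hrO⟩ := mem_nhds_iff.1 hN
  refine ⟨O, hO, hrO, fun {m e} he hesmooth => ?_⟩
  have hplot := hK (p := fun x => (q (e x), a (e x)))
    ⟨isPlot_reparam hq hesmooth, hsmooth hesmooth.isPlot fun x => hON (he x)⟩
    fun x => ⟨hs _, ha _ (hON (he x))⟩
  change IsPlot fun x => K (q (e x)) (lift (p (q (e x))))
  simpa only [hk _ (hs _) _ (ha _ (hON (he _)))] using hplot

end IsSubduction

end Subduction

/-! ### Cocycles and their sections -/

section Sections

variable {X Y Z Z' : Type*} [DiffeologicalSpace Y] [DiffeologicalSpace Z] [DiffeologicalSpace Z']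
  {G : Type*} [AddCommGroup G] [DiffeologicalSpace G] {π : Y → X} {F : Y → Y → G}

/-- A smooth `G`-valued `1`-cocycle on `Y ×_X Y`, as a function of two points of `Y` whose values
are relevant only on the fiber product. -/
structure IsCocycle (π : Y → X) (F : Y → Y → G) : Prop where
  add : ∀ ⦃a b c⦄, π a = π b → π b = π c → F a c = F a b + F b c
  smooth : DSmoothOn (fun w : Y × Y => F w.1 w.2) {w | π w.1 = π w.2}

/-- A smooth section over `s` of the pullback along `p` of the principal `G`-bundle glued from
`Y × G` by the cocycle `F`: `σ z` is the expression of the section in the charts indexed by the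
points of the fiber of `π` over `p z`. -/
structure IsSection (π : Y → X) (F : Y → Y → G) (s : Set Z) (p : Z → X) (σ : Z → Y → G) :
    Prop where
  add : ∀ ⦃z⦄, z ∈ s → ∀ ⦃a b⦄, π a = p z → π b = p z → σ z b = σ z a + F a b
  smooth : DSmoothOn (fun w : Z × Y => σ w.1 w.2) (fiberProd π s p)

/-- Triviality over `s` of the pullback along `p` of the bundle defined by a cocycle. -/
def HasSection (π : Y → X) (F : Y → Y → G) (s : Set Z) (p : Z → X) : Prop :=
  ∃ σ, IsSection π F s p σ

namespace IsSection

variable {s t : Set Z} {p : Z → X} {σ τ : Z → Y → G}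

theorem comp (h : IsSection π F t p σ) {s : Set Z'} {f : Z' → Z} {q : Z' → X}
    (hf : DSmoothOn f s) (hst : MapsTo f s t) (hq : EqOn q (fun z => p (f z)) s) :
    IsSection π F s q fun z => σ (f z) where
  add _ hz _ _ ha hb := h.add (hst hz) (ha.trans (hq hz)) (hb.trans (hq hz))
  smooth := h.smooth.comp
    (((hf.comp (dSmoothOn_of_dSmooth dSmooth_fst _) fun _ hw => hw.1)).prodMk
      (dSmoothOn_of_dSmooth dSmooth_snd _))
    fun _ hw => ⟨hst hw.1, hw.2.trans (hq hw.1)⟩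

theorem mono (h : IsSection π F t p σ) (hst : s ⊆ t) : IsSection π F s p σ :=
  h.comp (f := id) (dSmoothOn_of_dSmooth dSmooth_id s) hst fun _ _ => rfl

theorem congr (h : IsSection π F s p σ) (hτ : ∀ z ∈ s, ∀ a, π a = p z → τ z a = σ z a) :
    IsSection π F s p τ where
  add z hz a b ha hb := by rw [hτ z hz a ha, hτ z hz b hb, h.add hz ha hb]
  smooth := h.smooth.congr fun _ hw => hτ _ hw.1 _ hw.2

theorem of_locally [TopologicalSpace Z] [ContinuousPlots Z]
    (h : ∀ z ∈ s, ∃ N ∈ 𝓝 z, IsSection π F (s ∩ N) p σ) : IsSection π F s p σ where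
  add z hz := by
    obtain ⟨N, hN, hσ⟩ := h z hz
    exact hσ.add ⟨hz, mem_of_mem_nhds hN⟩
  smooth := by
    refine .of_locally (dSmoothOn_of_dSmooth dSmooth_fst _) fun w hw => ?_
    obtain ⟨N, hN, hσ⟩ := h w.1 hw.1
    exact ⟨N, hN, hσ.smooth.mono fun v hv => ⟨⟨hv.1.1, hv.2⟩, hv.1.2⟩⟩

theorem piecewise [TopologicalSpace Z] [ContinuousPlots Z] {A B : Set Z}
    [∀ z, Decidable (z ∈ A)] (hA : IsOpen A) (hB : IsOpen B) (hs : s ⊆ A ∪ B)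
    (hσ : IsSection π F (s ∩ A) p σ) (hτ : IsSection π F (s ∩ B) p τ)
    (hστ : ∀ z ∈ s, z ∈ A → z ∈ B → ∀ a, π a = p z → σ z a = τ z a) :
    IsSection π F s p (A.piecewise σ τ) := by
  refine of_locally fun z hz => ?_
  rcases hs hz with hzA | hzB
  · refine ⟨A, hA.mem_nhds hzA, hσ.congr fun y hy _ _ => ?_⟩
    rw [piecewise_eq_of_mem _ _ _ hy.2]
  · refine ⟨B, hB.mem_nhds hzB, hτ.congr fun y hy a ha => ?_⟩
    by_cases hyA : y ∈ A
    · rw [piecewise_eq_of_mem _ _ _ hyA, hστ y hy.1 hyA hy.2 a ha]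
    · rw [piecewise_eq_of_notMem _ _ _ hyA]

theorem add_function [AbelianDiffeologicalGroup G] (h : IsSection π F s p σ) {d : Z → G}
    (hd : DSmoothOn d s) : IsSection π F s p fun z a => σ z a + d z where
  add z hz a b ha hb := by rw [h.add hz ha hb]; abel
  smooth := h.smooth.add (hd.comp (dSmoothOn_of_dSmooth dSmooth_fst _) fun _ hw => hw.1)

theorem exists_eq_add_function [DiffeologicalSpace X] [AbelianDiffeologicalGroup G]
    (hπ : IsSubduction π) (hp : DSmoothOn p s) (hσ : IsSection π F s p σ)
    (hτ : IsSection π F s p τ) :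
    ∃ d : Z → G, DSmoothOn d s ∧ ∀ z ∈ s, ∀ a, π a = p z → τ z a = σ z a + d z := by
  obtain ⟨d, hd, hdiff⟩ := hπ.exists_descent (K := fun z a => τ z a - σ z a) hp
    (hτ.smooth.sub hσ.smooth) fun z hz a b ha hb => by
      rw [hσ.add hz ha hb, hτ.add hz ha hb, add_sub_add_right_eq_sub]
  exact ⟨d, hd, fun z hz a ha => by rw [← hdiff z hz a ha, add_sub_cancel]⟩

theorem sigma {ι : Type*} {Z : ι → Type*} [∀ i, DiffeologicalSpace (Z i)]
    {p : (Σ i, Z i) → X} {σ : ∀ i, Z i → Y → G}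
    (h : ∀ i, IsSection π F univ (fun z => p ⟨i, z⟩) (σ i)) :
    IsSection π F univ p fun z => σ z.1 z.2 where
  add z _ a b ha hb := (h z.1).add (mem_univ z.2) ha hb
  smooth n w hw hmem := by
    refine DiffeologicalSpace.locality fun x => ?_
    obtain ⟨V, hxV, i, c, hc, hwc⟩ := hw.1 x
    refine ⟨V, V.2, hxV, fun {m e} he hesmooth => ?_⟩
    have hwe : ∀ r, (w (e r)).1 = ⟨i, c ⟨e r, he r⟩⟩ := fun r => hwc ⟨e r, he r⟩
    have hσe : (fun r => σ (w (e r)).1.1 (w (e r)).1.2 (w (e r)).2) =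
        fun r => σ i (c ⟨e r, he r⟩) (w (e r)).2 := funext fun r => by rw [hwe r]
    change IsPlot fun r => σ (w (e r)).1.1 (w (e r)).1.2 (w (e r)).2
    rw [hσe]
    have hsmooth := (h i).smooth
    exact hsmooth (p := fun r => (c ⟨e r, he r⟩, (w (e r)).2))
      ⟨hc m (fun r => ⟨e r, he r⟩) hesmooth.isPlot, isPlot_reparam hw.2 hesmooth⟩
      fun r => ⟨trivial, (hmem (e r)).2.trans (congrArg p (hwe r))⟩

end IsSection

theorem HasSection.mono {s t : Set Z} {p : Z → X} (h : HasSection π F t p) (hst : s ⊆ t) :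
    HasSection π F s p :=
  h.imp fun _ hσ => hσ.mono hst

theorem IsCocycle.isSection (hF : IsCocycle π F) {s : Set Z} {p : Z → X} {a : Z → Y}
    (ha : DSmoothOn a s) (hap : ∀ z ∈ s, π (a z) = p z) : IsSection π F s p fun z => F (a z) where
  add z hz _ _ hb hc := hF.add ((hap z hz).trans hb.symm) (hb.trans hc.symm)
  smooth := hF.smooth.comp
    ((ha.comp (dSmoothOn_of_dSmooth dSmooth_fst _) fun _ hw => hw.1).prodMk
      (dSmoothOn_of_dSmooth dSmooth_snd _))
    fun _ hw => (hap _ hw.1).trans hw.2.symm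

theorem IsCocycle.self_eq_zero (hF : IsCocycle π F) (a : Y) : F a a = 0 := by
  simpa using hF.add (rfl : π a = π a) rfl

end Sections

/-! ### Homotopy invariance of the pullback -/

theorem exists_contDiff_eventuallyEq_id {E : Type*} [NormedAddCommGroup E] [NormedSpace ℝ E]
    [HasContDiffBump E] {x : E} {s : Set E} (hs : s ∈ 𝓝 x) :
    ∃ κ : E → E, ContDiff ℝ ∞ κ ∧ (∀ y, κ y ∈ s) ∧ κ =ᶠ[𝓝 x] id := by
  obtain ⟨ε, hε, hball⟩ := Metric.mem_nhds_iff.1 hs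
  let χ : ContDiffBump x := ⟨ε / 2, ε, half_pos hε, half_lt_self hε⟩
  refine ⟨fun y => x + χ y • (y - x),
    contDiff_const.add (χ.contDiff.smul (contDiff_id.sub contDiff_const)), fun y => hball ?_, ?_⟩
  · rw [mem_ball_iff_norm, add_sub_cancel_left, norm_smul, Real.norm_of_nonneg χ.nonneg]
    rcases lt_or_ge (dist y x) ε with hy | hy
    · exact (mul_le_of_le_one_left (norm_nonneg _) χ.le_one).trans_lt (dist_eq_norm y x ▸ hy)
    · rwa [χ.zero_of_le_dist hy, zero_mul]
  · filter_upwards [χ.eventuallyEq_one] with y hy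
    simp [hy]

section Tube

variable {X Y Z G : Type*} [DiffeologicalSpace X] [DiffeologicalSpace Y] [TopologicalSpace Z]
  [DiffeologicalSpace Z] [ContinuousPlots Z] [AddCommGroup G] [DiffeologicalSpace G]
  [AbelianDiffeologicalGroup G] {π : Y → X} {F : Y → Y → G} {P : Z × ℝ → X}

/-- The difference `d` of the two sections only makes sense near the slice `m`; reparametrizing the
second variable by a map `κ` with values near `m` that is the identity at `m` extends `d` to a
correction of the second section. -/
theorem HasSection.prod_Ioo_union (hπ : IsSubduction π) (hP : DSmooth P) {O : Set Z}
    {a b c d m : ℝ} (hab : m ∈ Ioo a b) (hcd : m ∈ Ioo c d)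
    (h₁ : HasSection π F (O ×ˢ Ioo a b) P) (h₂ : HasSection π F (O ×ˢ Ioo c d) P) :
    HasSection π F (O ×ˢ Ioo a d) P := by
  classical
  obtain ⟨σ, hσ⟩ := h₁
  obtain ⟨τ, hτ⟩ := h₂
  obtain ⟨e, he, hτσ⟩ := IsSection.exists_eq_add_function hπ
    (dSmoothOn_of_dSmooth hP (O ×ˢ (Ioo a b ∩ Ioo c d)))
    (hτ.mono (prod_mono_right inter_subset_right)) (hσ.mono (prod_mono_right inter_subset_left))
  obtain ⟨κ, hκ, hκmem, hκid⟩ := exists_contDiff_eventuallyEq_id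
    (inter_mem (isOpen_Ioo.mem_nhds hab) (isOpen_Ioo.mem_nhds hcd))
  have hκm : ∀ᶠ t in 𝓝 m, κ t = t := hκid
  have hτ' : IsSection π F (O ×ˢ Ioo c d) P fun z y => τ z y + e (z.1, κ z.2) :=
    hτ.add_function <| he.comp
      (dSmoothOn_of_dSmooth dSmooth_fst _ |>.prodMk <|
        dSmoothOn_of_dSmooth (hκ.dSmooth.comp dSmooth_snd) _)
      fun z hz => ⟨hz.1, hκmem z.2⟩
  let A : Set (Z × ℝ) := {z | z.2 < m}
  let B : Set (Z × ℝ) := {z | m < z.2 ∨ ∀ᶠ t in 𝓝 z.2, κ t = t}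
  have hA : IsOpen A := isOpen_lt continuous_snd continuous_const
  have hB : IsOpen B := (isOpen_lt continuous_const continuous_snd).union
    (isOpen_setOfPred_eventually_nhds.preimage continuous_snd)
  have hBA : ∀ z ∈ B, z ∈ A → κ z.2 = z.2 := fun z hz hzA =>
    hz.elim (fun h => absurd h (not_lt_of_gt hzA)) Eventually.self_of_nhds
  have hcover : O ×ˢ Ioo a d ⊆ A ∪ B := fun z _ => by
    rcases lt_trichotomy z.2 m with h | h | h
    · exact .inl h
    · exact .inr (.inr (h ▸ hκm))
    · exact .inr (.inl h)
  refine ⟨_, IsSection.piecewise hA hB hcover (hσ.mono fun z hz => ?_) (hτ'.mono fun z hz => ?_)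
    fun z hz hzA hzB y hy => ?_⟩
  · exact ⟨hz.1.1, hz.1.2.1, hz.2.trans hab.2⟩
  · refine ⟨hz.1.1, ?_, hz.1.2.2⟩
    rcases hz.2 with h | h
    · exact hcd.1.trans h
    · exact h.self_of_nhds ▸ (hκmem z.2).2.1
  · have hκz := hBA z hzB hzA
    rw [hκz]
    exact hτσ z ⟨hz.1, hκz ▸ hκmem z.2⟩ y hy

theorem HasSection.exists_prod_Icc (hπ : IsSubduction π) (hP : DSmooth P)
    (hloc : ∀ z, ∃ N ∈ 𝓝 z, HasSection π F N P) (u : Z) (s t : ℝ) :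
    ∃ V ∈ 𝓝 u, HasSection π F (V ×ˢ Icc s t) P := by
  let R (s t : ℝ) : Prop :=
    ∃ a b, s ∈ Ioo a b ∧ t ∈ Ioo a b ∧ ∃ V ∈ 𝓝 u, HasSection π F (V ×ˢ Ioo a b) P
  have : Std.Symm R := ⟨fun s t ⟨a, b, hs, ht, h⟩ => ⟨a, b, ht, hs, h⟩⟩
  have hR_trans : IsTrans ℝ R := ⟨by
    rintro s t r ⟨a, b, hs, ht, V, hV, hVσ⟩ ⟨c, d, ht', hr, W, hW, hWσ⟩
    have hVσ := hVσ.mono (prod_mono_left (inter_subset_left (t := W)))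
    have hWσ := hWσ.mono (prod_mono_left (inter_subset_right (s := V)))
    rcases le_total s r with h | h
    · exact ⟨a, d, ⟨hs.1, h.trans_lt hr.2⟩, ⟨hs.1.trans_le h, hr.2⟩, V ∩ W, inter_mem hV hW,
        .prod_Ioo_union hπ hP ht ht' hVσ hWσ⟩
    · exact ⟨c, b, ⟨hr.1.trans_le h, hs.2⟩, ⟨hr.1, h.trans_lt hs.2⟩, V ∩ W, inter_mem hV hW,
        .prod_Ioo_union hπ hP ht' ht hWσ hVσ⟩⟩
  have hR : ∀ s, ∀ᶠ t in 𝓝 s, R s t := fun s => by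
    obtain ⟨N, hN, hσ⟩ := hloc (u, s)
    obtain ⟨V, hV, I, hI, hVI⟩ := mem_nhds_prod_iff.1 hN
    obtain ⟨a, b, hs, hab⟩ := mem_nhds_iff_exists_Ioo_subset.1 hI
    filter_upwards [isOpen_Ioo.mem_nhds hs] with t ht
    exact ⟨a, b, hs, ht, V, hV, hσ.mono ((prod_mono_right hab).trans hVI)⟩
  obtain ⟨a, b, hs, ht, V, hV, hσ⟩ := PreconnectedSpace.induction₂ R hR hR_trans s t
  exact ⟨V, hV, hσ.mono (prod_mono_right (Icc_subset_Ioo hs.1 ht.2))⟩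

end Tube

instance {E : Type*} [NormedAddCommGroup E] [NormedSpace ℝ E] [DiffeologicalSpace E]
    [IsContDiffCompatible E] : AbelianDiffeologicalGroup E where
  smooth_add _ _ hp := (hp.1.contDiff.add hp.2.contDiff).isPlot
  smooth_neg _ _ hp := hp.contDiff.neg.isPlot

section PartitionOfUnity

variable {ι Z : Type*} [TopologicalSpace Z] (ρ : PartitionOfUnity ι Z)

theorem partitionOfUnity_sum_mem_Icc (I : Finset ι) (u : Z) : ∑ i ∈ I, ρ i u ∈ Icc (0 : ℝ) 1 := by
  classical
  refine ⟨Finset.sum_nonneg fun i _ => ρ.nonneg i u, ?_⟩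
  calc
    ∑ i ∈ I, ρ i u ≤ ∑ i ∈ I ∪ ρ.finsupport u, ρ i u :=
      Finset.sum_le_sum_of_subset_of_nonneg Finset.subset_union_left fun i _ _ => ρ.nonneg i u
    _ = 1 := ρ.sum_finsupport' (mem_univ u) Finset.subset_union_right

theorem partitionOfUnity_eventually_sum_range_eq_one (ρ : PartitionOfUnity ℕ Z) (u : Z) :
    ∀ᶠ k in atTop, ∀ᶠ v in 𝓝 u, ∑ i ∈ Finset.range k, ρ i v = 1 := by
  obtain ⟨m, hm⟩ := (ρ.fintsupport u).exists_nat_subset_range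
  filter_upwards [eventually_ge_atTop m] with k hk
  filter_upwards [ρ.eventually_finsupport_subset u] with v hv
  exact ρ.sum_finsupport' (mem_univ v) <|
    hv.trans (hm.trans (Finset.range_subset_range.2 hk))

end PartitionOfUnity

section Transport

variable {X Y Z G : Type*} [DiffeologicalSpace X] [DiffeologicalSpace Y] [TopologicalSpace Z]
  [DiffeologicalSpace Z] [ContinuousPlots Z] [AddCommGroup G] [DiffeologicalSpace G]
  [AbelianDiffeologicalGroup G] {π : Y → X} {F : Y → Y → G} {P : Z × ℝ → X}

theorem IsSection.exists_transport (hπ : IsSubduction π) (hP : DSmooth P) {V : Set Z} {I : Set ℝ}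
    (hV : IsOpen V) (hVI : HasSection π F (V ×ˢ I) P) {s s' : Z → ℝ} (hs : DSmooth s)
    (hs' : DSmooth s') (hsI : ∀ u, s u ∈ I) (hsI' : ∀ u, s' u ∈ I) (hss' : tsupport (s' - s) ⊆ V)
    {θ : Z → Y → G} (hθ : IsSection π F univ (fun u => P (u, s u)) θ) :
    ∃ θ', IsSection π F univ (fun u => P (u, s' u)) θ' ∧
      ∀ u ∉ tsupport (s' - s), θ' u = θ u := by
  classical
  obtain ⟨τ, hτ⟩ := hVI
  have hgraph {r : Z → ℝ} (hr : DSmooth r) : DSmooth fun u => (u, r u) :=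
    fun _ _ hp => ⟨hp, hr _ _ hp⟩
  have hτ_along {r : Z → ℝ} (hr : DSmooth r) (hrI : ∀ u, r u ∈ I) :
      IsSection π F V (fun u => P (u, r u)) fun u => τ (u, r u) :=
    hτ.comp (dSmoothOn_of_dSmooth (hgraph hr) V) (fun u hu => ⟨hu, hrI u⟩) fun _ _ => rfl
  obtain ⟨d, hd, hθτ⟩ := IsSection.exists_eq_add_function hπ
    (dSmoothOn_of_dSmooth (hP.comp (hgraph hs)) V) (hτ_along hs hsI) (hθ.mono (subset_univ V))
  have heq : ∀ u ∈ (tsupport (s' - s))ᶜ, s' u = s u := fun u hu =>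
    sub_eq_zero.1 (image_eq_zero_of_notMem_tsupport (f := s' - s) hu)
  refine ⟨_, IsSection.piecewise (A := (tsupport (s' - s))ᶜ) (B := V) (σ := θ)
    (τ := fun u a => τ (u, s' u) a + d u) (isClosed_tsupport _).isOpen_compl hV
    (fun u _ => (em (u ∈ tsupport (s' - s))).symm.imp id fun h => hss' h) ?_ ?_ ?_,
    fun u hu => piecewise_eq_of_mem _ _ _ hu⟩
  · refine hθ.comp (dSmoothOn_of_dSmooth dSmooth_id _) (mapsTo_univ _ _) fun u hu => ?_
    simp only [heq u hu.2]
  · exact ((hτ_along hs' hsI').add_function hd).mono inter_subset_right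
  · intro u _ hu huV a ha
    rw [heq u hu] at ha ⊢
    exact hθτ u huV a ha

/-- Push the section from time `0` to time `1` by successively adding the functions of the
partition of unity to the time; near each point the process stops after finitely many steps. -/
theorem HasSection.transport (hπ : IsSubduction π) (hP : DSmooth P) (ρ : PartitionOfUnity ℕ Z)
    (hρ : ∀ i, DSmooth (ρ i))
    (hVρ : ∀ i, ∃ V, IsOpen V ∧ tsupport (ρ i) ⊆ V ∧ HasSection π F (V ×ˢ Icc 0 1) P)
    (h₀ : HasSection π F univ fun u => P (u, 0)) : HasSection π F univ fun u => P (u, 1) := by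
  let s (k : ℕ) (u : Z) : ℝ := ∑ i ∈ Finset.range k, ρ i u
  have hs (k : ℕ) : DSmooth (s k) := by
    have := (smoothMaps Z ℝ).sum_mem (t := Finset.range k) fun i _ => hρ i
    rwa [Finset.sum_fn] at this
  have hsI (k : ℕ) (u : Z) : s k u ∈ Icc (0 : ℝ) 1 := partitionOfUnity_sum_mem_Icc ρ _ u
  have hs_succ (k : ℕ) : s (k + 1) - s k = ρ k := by
    ext u
    simp [s, Finset.sum_range_succ]
  have hstep (k : ℕ) (θ : {θ : Z → Y → G // IsSection π F univ (fun u => P (u, s k u)) θ}) :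
      ∃ θ' : {θ : Z → Y → G // IsSection π F univ (fun u => P (u, s (k + 1) u)) θ},
        ∀ u ∉ tsupport (ρ k), θ'.1 u = θ.1 u := by
    obtain ⟨V, hV, hρV, hVσ⟩ := hVρ k
    obtain ⟨θ', hθ', h⟩ := θ.2.exists_transport hπ hP hV hVσ (hs k) (hs (k + 1)) (hsI k)
      (hsI (k + 1)) (hs_succ k ▸ hρV)
    exact ⟨⟨θ', hθ'⟩, hs_succ k ▸ h⟩
  choose next hnext using hstep
  obtain ⟨θ₀, hθ₀⟩ := h₀
  let θ (k : ℕ) : {θ : Z → Y → G // IsSection π F univ (fun u => P (u, s k u)) θ} :=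
    Nat.rec ⟨θ₀, by simpa [s] using hθ₀⟩ next k
  have hfinite : LocallyFinite fun k => {u | (θ (k + 1)).1 u ≠ (θ k).1 u} :=
    ρ.locallyFinite_tsupport.subset fun k u hu => by
      contrapose! hu
      exact not_not_intro (hnext k (θ k) u hu)
  obtain ⟨Θ, hΘ⟩ := hfinite.exists_forall_eventually_atTop_eventuallyEq (f := fun k => (θ k).1)
  refine ⟨Θ, .of_locally fun u _ => ?_⟩
  obtain ⟨k, hk, hsk⟩ := ((hΘ u).and (partitionOfUnity_eventually_sum_range_eq_one ρ u)).exists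
  refine ⟨_, inter_mem hk hsk, ?_⟩
  refine IsSection.congr (σ := (θ k).1) ((θ k).2.comp (dSmoothOn_of_dSmooth dSmooth_id _)
    (mapsTo_univ _ _) fun v hv => ?_) fun v hv a _ => (congrFun hv.2.1 a).symm
  exact congrArg (fun t => P (v, t)) (Eq.symm hv.2.2)

end Transport

/-! ### Contractible domains -/

section Manifold

open scoped Manifold

variable {n : ℕ} {U : Opens (EuclideanSpace ℝ (Fin n))}

theorem contMDiff_of_isPlot {m : ℕ} {p : EuclideanSpace ℝ (Fin m) → U} (hp : IsPlot p) :
    ContMDiff 𝓘(ℝ, EuclideanSpace ℝ (Fin m)) 𝓘(ℝ, EuclideanSpace ℝ (Fin n)) ∞ p :=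
  (ContMDiff.subtypeVal_comp_iff U p).1
    (IsPlot.contDiff (X := EuclideanSpace ℝ (Fin n)) hp).contMDiff

theorem exists_partitionOfUnity_dSmooth [Nonempty U] {V : U → Set U} (hV : ∀ u, V u ∈ 𝓝 u) :
    ∃ ρ : PartitionOfUnity ℕ U, (∀ i, DSmooth (ρ i)) ∧
      ∀ i, ∃ u, tsupport (ρ i) ⊆ interior (V u) := by
  have : LocallyCompactSpace U := U.2.locallyCompactSpace
  obtain ⟨S, hS, hcover⟩ :=
    TopologicalSpace.countable_cover_nhds fun u => interior_mem_nhds.2 (hV u)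
  have hne : S.Nonempty := by
    by_contra! h
    simp [h, eq_comm (a := ∅)] at hcover
  obtain ⟨x, rfl⟩ := hS.exists_eq_range hne
  obtain ⟨ρ, hρ⟩ := SmoothPartitionOfUnity.exists_isSubordinate 𝓘(ℝ, EuclideanSpace ℝ (Fin n))
    isClosed_univ (fun i => interior (V (x i))) (fun _ => isOpen_interior)
    (by rw [← hcover, biUnion_range])
  exact ⟨ρ.toPartitionOfUnity,
    fun i _ _ hp => ((ρ i).contMDiff.comp (contMDiff_of_isPlot hp)).contDiff.isPlot,
    fun i => ⟨x i, hρ i⟩⟩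

theorem exists_continuous_forall_ball_subset {E : Type*} [PseudoMetricSpace E] {U : Set E}
    (hU : IsOpen U) :
    ∃ ε : E → ℝ, Continuous ε ∧ ∀ x ∈ U, 0 < ε x ∧ Metric.ball x (ε x) ⊆ U := by
  rcases Uᶜ.eq_empty_or_nonempty with h | h
  · exact ⟨fun _ => 1, continuous_const, fun _ _ => ⟨one_pos, by simp [compl_empty_iff.1 h]⟩⟩
  · exact ⟨fun x => Metric.infDist x Uᶜ, Metric.continuous_infDist_pt _, fun x hx =>
      ⟨(hU.isClosed_compl.notMem_iff_infDist_pos h).1 (not_not_intro hx),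
        Metric.ball_infDist_compl_subset⟩⟩

/-- Approximate a continuous contraction, reparametrized so as to be stationary near the ends, by a
smooth map which agrees with it at the ends. -/
theorem exists_dSmooth_contraction (U : Opens (EuclideanSpace ℝ (Fin n))) [ContractibleSpace U] :
    ∃ (x₀ : U) (H : U × ℝ → U), Continuous H ∧ DSmooth H ∧ (∀ x, H (x, 0) = x₀) ∧
      ∀ x, H (x, 1) = x := by
  obtain ⟨x₀, ⟨K⟩⟩ := id_nullhomotopic U
  obtain ⟨ε, hεc, hε⟩ := exists_continuous_forall_ball_subset U.2
  have : LocallyCompactSpace U := U.2.locallyCompactSpace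
  let k (z : U × ℝ) : U := K (projIcc 0 1 zero_le_one (2 - 3 * z.2), z.1)
  have hk : Continuous k := by fun_prop
  have hk₀ (z : U × ℝ) (hz : z.2 < 1 / 3) : k z = x₀ := by
    simp [k, projIcc_of_right_le zero_le_one (show 1 ≤ 2 - 3 * z.2 by linarith)]
  have hk₁ (z : U × ℝ) (hz : 2 / 3 < z.2) : k z = z.1 := by
    simp [k, projIcc_of_le_left zero_le_one (show 2 - 3 * z.2 ≤ 0 by linarith)]
  have hopen₀ : IsOpen {z : U × ℝ | z.2 < 1 / 3} := isOpen_lt continuous_snd continuous_const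
  have hopen₁ : IsOpen {z : U × ℝ | 2 / 3 < z.2} := isOpen_lt continuous_const continuous_snd
  have hsmooth : ContMDiffOn (𝓘(ℝ, EuclideanSpace ℝ (Fin n)).prod 𝓘(ℝ))
      𝓘(ℝ, EuclideanSpace ℝ (Fin n)) ∞ (fun z => (k z : EuclideanSpace ℝ (Fin n)))
      ({z | z.2 < 1 / 3} ∪ {z | 2 / 3 < z.2}) :=
    .union_of_isOpen (contMDiffOn_const.congr fun z hz => congrArg Subtype.val (hk₀ z hz))
      ((contMDiff_subtype_val.comp contMDiff_fst).contMDiffOn.congr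
        fun z hz => congrArg Subtype.val (hk₁ z hz)) hopen₀ hopen₁
  have hclosed : IsClosed {z : U × ℝ | z.2 = 0 ∨ z.2 = 1} :=
    (isClosed_eq continuous_snd continuous_const).union
      (isClosed_eq continuous_snd continuous_const)
  obtain ⟨g, hgk, hg, -⟩ := Continuous.exists_contMDiff_approx_and_eqOn
    (𝓘(ℝ, EuclideanSpace ℝ (Fin n)).prod 𝓘(ℝ)) (⊤ : ℕ∞) (continuous_subtype_val.comp hk)
    (hεc.comp (continuous_subtype_val.comp hk)) (fun z => (hε _ (k z).2).1) hclosed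
    ((hopen₀.union hopen₁).mem_nhdsSet.2 fun z hz => hz.imp
      (fun h : z.2 = 0 => by simp [h]) fun h : z.2 = 1 => by norm_num [h]) hsmooth
  refine ⟨x₀, fun z => ⟨g z, (hε _ (k z).2).2 (hgk z)⟩, g.contMDiff.continuous.subtype_mk _,
    fun m p hp => ?_, fun x => ?_, fun x => ?_⟩
  · exact (g.contMDiff.comp
      ((contMDiff_of_isPlot hp.1).prodMk hp.2.contDiff.contMDiff)).contDiff.isPlot
  · exact Subtype.ext ((hg (.inl rfl)).trans (congrArg Subtype.val (hk₀ _ (by norm_num))))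
  · exact Subtype.ext ((hg (.inr rfl)).trans (congrArg Subtype.val (hk₁ _ (by norm_num))))

end Manifold

section Contractible

variable {X Y G : Type*} [DiffeologicalSpace X] [DiffeologicalSpace Y] [AddCommGroup G]
  [DiffeologicalSpace G] [AbelianDiffeologicalGroup G] {π : Y → X} {F : Y → Y → G}

theorem IsCocycle.hasSection_of_contractibleSpace (hπ : IsSubduction π) (hF : IsCocycle π F)
    {n : ℕ} {U : Opens (EuclideanSpace ℝ (Fin n))} [ContractibleSpace U] {p : U → X}
    (hp : DSmooth p) : HasSection π F univ p := by
  obtain ⟨x₀, H, hHc, hH, hH₀, hH₁⟩ := exists_dSmooth_contraction U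
  have hP : DSmooth fun z => p (H z) := hp.comp hH
  have hloc : ∀ z, ∃ N ∈ 𝓝 z, HasSection π F N fun z => p (H z) := fun z => by
    obtain ⟨N, hN, a, ha, hap⟩ := hπ.exists_lift hp (H z)
    exact ⟨_, hHc.continuousAt.preimage_mem_nhds hN, _, hF.isSection
      (ha.comp (dSmoothOn_of_dSmooth hH _) fun _ hz => hz) fun z hz => hap _ hz⟩
  choose V hV hVσ using fun u => HasSection.exists_prod_Icc hπ hP hloc u 0 1
  obtain ⟨ρ, hρ, hρV⟩ := exists_partitionOfUnity_dSmooth hV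
  obtain ⟨y, hy⟩ := hπ.surjective (p x₀)
  have h₀ : HasSection π F univ fun u => p (H (u, 0)) :=
    ⟨_, hF.isSection (a := fun _ => y) (dSmoothOn_of_dSmooth dSmooth_const _) fun u _ => by
      rw [hH₀, hy]⟩
  simpa only [hH₁] using HasSection.transport hπ hP ρ hρ (fun i => by
    obtain ⟨u, hu⟩ := hρV i
    exact ⟨_, isOpen_interior, hu, (hVσ u).mono (prod_mono_left interior_subset)⟩) h₀

end Contractible

/-! ### Cocycles on nebulae -/

section Nebula

variable {X : Type*} [DiffeologicalSpace X]

theorem dSmooth_ev (Q : GeneratingFamily X) : DSmooth (ev Q) := fun n p hp => by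
  refine DiffeologicalSpace.locality fun x => ?_
  obtain ⟨V, hxV, q, c, hc, hpc⟩ := hp x
  refine ⟨V, V.2, hxV, fun {m e} he hesmooth => ?_⟩
  have hev : ∀ r, ev Q (p (e r)) = q.1.toFun (c ⟨e r, he r⟩) := fun r => by
    rw [hpc ⟨e r, he r⟩, ev]
  change IsPlot fun r => ev Q (p (e r))
  simp only [hev]
  exact q.1.smooth _ _ (hc m (fun r => ⟨e r, he r⟩) hesmooth.isPlot)

theorem isSubduction_ev (Q : GeneratingFamily X) : IsSubduction (ev Q) where
  smooth := dSmooth_ev Q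
  exists_lift {n U p} hp x := by
    obtain ⟨V, hVU, hxV, q, hq, f, hf, hpf⟩ := Q.generating ⟨n, U, p, hp⟩ x
    have lift_apply (r : U) (hr : r.1 ∈ V) :
        extend (fun v : V => (v : EuclideanSpace ℝ (Fin n)))
          (fun v => (⟨⟨q, hq⟩, f v⟩ : Nebula Q)) (fun _ => ⟨⟨q, hq⟩, f ⟨x, hxV⟩⟩) r =
        ⟨⟨q, hq⟩, f ⟨r, hr⟩⟩ :=
      Subtype.val_injective.extend_apply _ _ (⟨r, hr⟩ : V)
    refine ⟨{r | r.1 ∈ V}, (V.2.preimage continuous_subtype_val).mem_nhds hxV, _, ?_,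
      fun r hr => (congrArg (ev Q) (lift_apply r hr)).trans (hpf ⟨r, hr⟩).symm⟩
    intro m e he heV y
    exact ⟨⊤, trivial, ⟨q, hq⟩, fun z => f ⟨e z, heV z⟩,
      hf.comp fun k r hr => isPlot_reparam he (IsPlot.contDiff (X := EuclideanSpace ℝ (Fin m)) hr),
      fun z => lift_apply _ (heV z)⟩

variable {Q R : GeneratingFamily X} {G : Type*} [AddCommGroup G] [DiffeologicalSpace G]
  [AbelianDiffeologicalGroup G]

theorem IsCocycle.hasSection_ev {F : Nebula R → Nebula R → G} (hF : IsCocycle (ev R) F)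
    (hQ : ∀ q ∈ Q.plots, ContractibleSpace q.domain) : HasSection (ev R) F univ (ev Q) := by
  have (q : Q.plots) : HasSection (ev R) F univ q.1.toFun :=
    have := hQ q.1 q.2
    hF.hasSection_of_contractibleSpace (isSubduction_ev R) q.1.smooth
  choose σ hσ using this
  exact ⟨_, IsSection.sigma hσ⟩

open Classical in
/-- A `1`-cochain as a function of two points of the nebula, extended by zero from the fiber
product to all pairs. -/
def pairValue (f : Cochains Q G 1) (a b : Nebula Q) : G :=
  if h : ev Q a = ev Q b then f.1 (NebulaPower.pair a b h) else 0

theorem pairValue_of_eq (f : Cochains Q G 1) {a b : Nebula Q} (h : ev Q a = ev Q b) :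
    pairValue f a b = f.1 (NebulaPower.pair a b h) := dif_pos h

theorem apply_eq_pairValue (f : Cochains Q G 1) (x : NebulaPower Q 1) :
    f.1 x = pairValue f (x.1 0) (x.1 1) := by
  rw [pairValue_of_eq f (x.2 0 1)]
  refine congrArg f.1 (Subtype.ext (funext fun i => ?_))
  fin_cases i <;> rfl

theorem pairValue_add (f g : Cochains Q G 1) (a b : Nebula Q) :
    pairValue (f + g) a b = pairValue f a b + pairValue g a b := by
  by_cases h : ev Q a = ev Q b
  · simp only [pairValue_of_eq _ h]
    rfl
  · simp only [pairValue, dif_neg h, add_zero]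

theorem dSmoothOn_pairValue (f : Cochains Q G 1) :
    DSmoothOn (fun w : Nebula Q × Nebula Q => pairValue f w.1 w.2) {w | ev Q w.1 = ev Q w.2} :=
  fun n w hw hmem => by
    simp only [fun r => pairValue_of_eq f (hmem r)]
    refine f.2 n (fun r => NebulaPower.pair _ _ (hmem r)) fun i => ?_
    fin_cases i
    exacts [hw.1, hw.2]

theorem coboundary_one_apply (f : Cochains Q G 1) (x : NebulaPower Q 2) :
    (coboundary Q G 1 f).1 x =
      pairValue f (x.1 1) (x.1 2) - pairValue f (x.1 0) (x.1 2) + pairValue f (x.1 0) (x.1 1) := by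
  have : (coboundary Q G 1 f).1 x =
      f.1 (face Q 1 0 x) - f.1 (face Q 1 1 x) + f.1 (face Q 1 2 x) := by
    simp [coboundary, Fin.sum_univ_three, precomp, sub_eq_add_neg]
  simp only [this, apply_eq_pairValue]
  rfl

/-- A point of the nebula as an element of `N(Q)_0`. -/
def nebulaPoint (y : Nebula Q) : NebulaPower Q 0 := ⟨fun _ => y, fun _ _ => rfl⟩

theorem coboundary_zero_apply (h : Cochains Q G 0) (x : NebulaPower Q 1) :
    (coboundary Q G 0 h).1 x = h.1 (nebulaPoint (x.1 1)) - h.1 (nebulaPoint (x.1 0)) := by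
  have : (coboundary Q G 0 h).1 x = h.1 (face Q 0 0 x) - h.1 (face Q 0 1 x) := by
    simp [coboundary, precomp, sub_eq_add_neg]
  rw [this]
  refine congrArg₂ _ (congrArg h.1 ?_) (congrArg h.1 ?_) <;>
    exact Subtype.ext (funext fun i => by fin_cases i; rfl)

theorem isCocycle_pairValue (f : cocycles Q G 1) : IsCocycle (ev Q) (pairValue f.1) where
  add a b c hab hbc := by
    let x : NebulaPower Q 2 := ⟨![a, b, c], by
      intro i j
      fin_cases i <;> fin_cases j <;> simp [hab, hbc]⟩
    have hcob : coboundary Q G 1 f.1 = 0 := f.2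
    have h : 0 = pairValue f.1 b c - pairValue f.1 a c + pairValue f.1 a b := by
      simpa only [hcob] using! coboundary_one_apply f.1 x
    rw [← sub_eq_zero, ← neg_eq_zero, h]
    abel
  smooth := dSmoothOn_pairValue f.1

namespace IsCocycle

variable {F : Nebula Q → Nebula Q → G}

/-- The Čech `1`-cocycle given by a cocycle function of two points of the nebula. -/
def toCocycle (hF : IsCocycle (ev Q) F) : cocycles Q G 1 :=
  ⟨⟨fun x => F (x.1 0) (x.1 1), fun _ p hp =>
      hF.smooth (p := fun r => ((p r).1 0, (p r).1 1)) ⟨hp 0, hp 1⟩ fun r => (p r).2 0 1⟩,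
    Subtype.ext <| funext fun x => by
      simp only [coboundary_one_apply, pairValue_of_eq _ (x.2 _ _)]
      change F (x.1 1) (x.1 2) - F (x.1 0) (x.1 2) + F (x.1 0) (x.1 1) = 0
      rw [hF.add (x.2 0 1) (x.2 1 2)]
      abel⟩

theorem pairValue_toCocycle (hF : IsCocycle (ev Q) F) {a b : Nebula Q} (h : ev Q a = ev Q b) :
    pairValue hF.toCocycle.1 a b = F a b :=
  pairValue_of_eq _ h

end IsCocycle

theorem mk_eq_mk_iff {f g : cocycles Q G 1} :
    (QuotientAddGroup.mk f : FamilyCohomology Q G 1) = QuotientAddGroup.mk g ↔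
      ∃ h : Nebula Q → G, DSmooth h ∧ ∀ a b, ev Q a = ev Q b →
        pairValue g.1 a b = pairValue f.1 a b + (h b - h a) := by
  rw [QuotientAddGroup.eq]
  constructor
  · rintro ⟨h, hh⟩
    refine ⟨fun y => h.1 (nebulaPoint y), fun n p hp =>
      h.2 n (fun r => nebulaPoint (p r)) fun _ => hp, fun a b hab => ?_⟩
    have hcob : h.1 (nebulaPoint b) - h.1 (nebulaPoint a) =
        -f.1.1 (NebulaPower.pair a b hab) + g.1.1 (NebulaPower.pair a b hab) :=
      (coboundary_zero_apply h (NebulaPower.pair a b hab)).symm.trans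
        (congrArg (fun z : Cochains Q G 1 => z.1 (NebulaPower.pair a b hab)) hh)
    rw [pairValue_of_eq _ hab, pairValue_of_eq _ hab, hcob, add_neg_cancel_left]
  · rintro ⟨h, hh, hfg⟩
    refine ⟨⟨fun x => h (x.1 0), fun n p hp => hh n _ (hp 0)⟩, Subtype.ext <| funext fun x => ?_⟩
    rw [coboundary_zero_apply]
    change h (x.1 1) - h (x.1 0) = -f.1.1 x + g.1.1 x
    rw [apply_eq_pairValue f.1, apply_eq_pairValue g.1, hfg _ _ (x.2 0 1), neg_add_cancel_left]

theorem pairValue_cocycleMap (φ : Refinement Q R) (f : cocycles Q G 1) {a b : Nebula R}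
    (h : ev R a = ev R b) : pairValue (φ.cocycleMap G 1 f).1 a b =
      pairValue f.1 (φ.nebulaMap a) (φ.nebulaMap b) := by
  rw [pairValue_of_eq _ h]
  exact apply_eq_pairValue f.1 _

end Nebula

/-! ### Transitions between cocycles -/

section Transition

variable {X Y Y' Y'' : Type*} [DiffeologicalSpace Y] [DiffeologicalSpace Y']
  [DiffeologicalSpace Y''] {G : Type*} [AddCommGroup G] [DiffeologicalSpace G]
  {π : Y → X} {π' : Y' → X} {π'' : Y'' → X} {F F₁ F₂ : Y → Y → G} {F' F₁' F₂' : Y' → Y' → G}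
  {t t₁ t₂ : Y' → Y → G}

/-- A transition from a cocycle `F` on `Y` to a cocycle `F'` on `Y'`: an isomorphism over `X`
between the `G`-bundles that they define, expressed in the charts indexed by `Y` and `Y'`. -/
structure IsTransition (π : Y → X) (π' : Y' → X) (F : Y → Y → G) (F' : Y' → Y' → G)
    (t : Y' → Y → G) : Prop extends IsSection π F univ π' t where
  add_left : ∀ ⦃u v y⦄, π' u = π' v → π y = π' v → t u y = F' u v + t v y

theorem IsCocycle.isTransition_self (hF : IsCocycle π F) :
    IsTransition π π F F F where
  toIsSection := hF.isSection (dSmoothOn_of_dSmooth dSmooth_id _) fun _ _ => rfl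
  add_left _ _ _ huv hyv := hF.add huv hyv.symm

theorem IsSection.exists_isTransition [DiffeologicalSpace X] [AbelianDiffeologicalGroup G]
    (ht : IsSection π F univ π' t) (hπ : IsSubduction π) (hπ' : DSmooth π') :
    ∃ F', IsCocycle π' F' ∧ IsTransition π π' F F' t := by
  obtain ⟨k, hk, hkt⟩ := hπ.exists_descent (Z := Y' × Y') (s := {w | π' w.1 = π' w.2})
    (p := fun w => π' w.1) (K := fun w y => t w.1 y - t w.2 y)
    (dSmoothOn_of_dSmooth (hπ'.comp dSmooth_fst) _)
    (((ht.comp (dSmoothOn_of_dSmooth dSmooth_fst _) (mapsTo_univ _ _) fun _ _ => rfl).smooth).sub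
      (ht.comp (dSmoothOn_of_dSmooth dSmooth_snd _) (mapsTo_univ _ _) fun _ hw => hw).smooth)
    fun w hw a b ha hb => by
      rw [ht.add (mem_univ w.1) ha hb, ht.add (mem_univ w.2) (ha.trans hw) (hb.trans hw),
        add_sub_add_right_eq_sub]
  refine ⟨fun u v => k (u, v), ⟨fun u v w huv hvw => ?_, hk⟩, ht, fun u v y huv hyv => ?_⟩
  · obtain ⟨y, hy⟩ := hπ.surjective (π' u)
    rw [← hkt (u, w) (huv.trans hvw) y hy, ← hkt (u, v) huv y hy,
      ← hkt (v, w) hvw y (hy.trans huv), sub_add_sub_cancel]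
  · rw [← hkt (u, v) huv y (hyv.trans huv.symm), sub_add_cancel]

namespace IsTransition

theorem congr (h : IsTransition π π' F F' t) (hF : ∀ a b, π a = π b → F₁ a b = F a b)
    (hF' : ∀ a b, π' a = π' b → F₁' a b = F' a b) : IsTransition π π' F₁ F₁' t where
  add z hz a b ha hb := by rw [hF a b (ha.trans hb.symm), h.add hz ha hb]
  smooth := h.smooth
  add_left u v y huv hyv := by rw [hF' u v huv, h.add_left huv hyv]

theorem add_transition [AbelianDiffeologicalGroup G] (h₁ : IsTransition π π' F₁ F₁' t₁)
    (h₂ : IsTransition π π' F₂ F₂' t₂) :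
    IsTransition π π' (fun a b => F₁ a b + F₂ a b) (fun a b => F₁' a b + F₂' a b)
      fun u y => t₁ u y + t₂ u y where
  add z hz a b ha hb := by
    rw [h₁.add hz ha hb, h₂.add hz ha hb, add_add_add_comm]
  smooth := h₁.smooth.add h₂.smooth
  add_left u v y huv hyv := by
    rw [h₁.add_left huv hyv, h₂.add_left huv hyv, add_add_add_comm]

theorem comp_left (h : IsTransition π π' F F' t) {φ : Y'' → Y'} (hφ : DSmooth φ)
    (hφπ : ∀ y, π' (φ y) = π'' y) :
    IsTransition π π'' F (fun u v => F' (φ u) (φ v)) fun u => t (φ u) where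
  toIsSection := h.comp (dSmoothOn_of_dSmooth hφ _) (mapsTo_univ _ _) fun y _ => (hφπ y).symm
  add_left u v _ huv hyv :=
    h.add_left ((hφπ u).trans (huv.trans (hφπ v).symm)) (hyv.trans (hφπ v).symm)

theorem comp_right (h : IsTransition π π' F F' t) {φ : Y'' → Y} (hφ : DSmooth φ)
    (hφπ : ∀ y, π (φ y) = π'' y) :
    IsTransition π'' π' (fun a b => F (φ a) (φ b)) F' fun u y => t u (φ y) where
  add _ hz a b ha hb := h.add hz ((hφπ a).trans ha) ((hφπ b).trans hb)
  smooth := h.smooth.comp ((dSmoothOn_of_dSmooth dSmooth_fst _).prodMk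
    (dSmoothOn_of_dSmooth (hφ.comp dSmooth_snd) _)) fun w hw => ⟨hw.1, (hφπ w.2).trans hw.2⟩
  add_left _ _ y huv hyv := h.add_left huv ((hφπ y).trans hyv)

theorem exists_coboundary_eq [DiffeologicalSpace X] [AbelianDiffeologicalGroup G]
    (hπ : IsSubduction π) (hπ' : DSmooth π') {d : Y → G} (hd : DSmooth d)
    (hF : ∀ a b, π a = π b → F₂ a b = F₁ a b + (d b - d a)) (h₁ : IsTransition π π' F₁ F₁' t₁)
    (h₂ : IsTransition π π' F₂ F₂' t₂) :
    ∃ e : Y' → G, DSmooth e ∧ ∀ u v, π' u = π' v → F₂' u v = F₁' u v + (e v - e u) := by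
  have hτ : IsSection π F₂ univ π' fun u y => t₁ u y + d y :=
    { add := fun u hu a b ha hb => by
        rw [h₁.add hu ha hb, hF a b (ha.trans hb.symm)]
        abel
      smooth := h₁.smooth.add (dSmoothOn_of_dSmooth (hd.comp dSmooth_snd) _) }
  obtain ⟨e, he, het⟩ := h₂.exists_eq_add_function hπ (dSmoothOn_of_dSmooth hπ' _) hτ
  refine ⟨e, dSmoothOn_univ.1 he, fun u v huv => ?_⟩
  obtain ⟨y, hy⟩ := hπ.surjective (π' v)
  have hu := het u trivial y (hy.trans huv.symm)
  have hv := het v trivial y hy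
  rw [h₁.add_left huv hy, h₂.add_left huv hy, add_assoc, hv] at hu
  rw [← sub_eq_zero, ← sub_eq_zero.2 hu.symm]
  abel

end IsTransition

end Transition

/-! ### The colimit -/

section Correspondence

variable {X : Type*} [DiffeologicalSpace X] {Q R S : GeneratingFamily X} {G : Type*}
  [AddCommGroup G] [DiffeologicalSpace G] [AbelianDiffeologicalGroup G]

/-- Two classes of degree one on different generating families correspond to each other when they
define isomorphic bundles, i.e. when there is a transition between representing cocycles. -/
def Corresponds (a : FamilyCohomology R G 1) (b : FamilyCohomology Q G 1) : Prop :=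
  ∃ (f : cocycles R G 1) (g : cocycles Q G 1) (t : Nebula Q → Nebula R → G),
    QuotientAddGroup.mk f = a ∧ QuotientAddGroup.mk g = b ∧
      IsTransition (ev R) (ev Q) (pairValue f.1) (pairValue g.1) t

namespace Corresponds

variable {a a' : FamilyCohomology R G 1} {b b' : FamilyCohomology Q G 1}

theorem refl (a : FamilyCohomology R G 1) : Corresponds a a := by
  obtain ⟨f, rfl⟩ := QuotientAddGroup.mk_surjective a
  exact ⟨f, f, _, rfl, rfl, (isCocycle_pairValue f).isTransition_self⟩

theorem add (h : Corresponds a b) (h' : Corresponds a' b') : Corresponds (a + a') (b + b') := by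
  obtain ⟨f, g, t, rfl, rfl, ht⟩ := h
  obtain ⟨f', g', t', rfl, rfl, ht'⟩ := h'
  exact ⟨f + f', g + g', _, rfl, rfl, (ht.add_transition ht').congr
    (fun _ _ _ => pairValue_add f.1 f'.1 _ _) fun _ _ _ => pairValue_add g.1 g'.1 _ _⟩

theorem right_unique (h : Corresponds a b) (h' : Corresponds a b') : b = b' := by
  obtain ⟨f, g, t, hf, rfl, ht⟩ := h
  obtain ⟨f', g', t', hf', rfl, ht'⟩ := h'
  obtain ⟨d, hd, hff'⟩ := mk_eq_mk_iff.1 (hf.trans hf'.symm)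
  exact mk_eq_mk_iff.2
    (IsTransition.exists_coboundary_eq (isSubduction_ev R) (dSmooth_ev Q) hd hff' ht ht')

theorem cohomologyMap_left (h : Corresponds a b) (φ : Refinement R S) :
    Corresponds (φ.cohomologyMap G 1 a) b := by
  obtain ⟨f, g, t, rfl, rfl, ht⟩ := h
  exact ⟨φ.cocycleMap G 1 f, g, _, rfl, rfl,
    (ht.comp_right φ.smooth_nebulaMap φ.ev_nebulaMap).congr
      (fun _ _ => pairValue_cocycleMap φ f) fun _ _ _ => rfl⟩

theorem cohomologyMap_right (h : Corresponds a b) (φ : Refinement Q S) :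
    Corresponds a (φ.cohomologyMap G 1 b) := by
  obtain ⟨f, g, t, rfl, rfl, ht⟩ := h
  exact ⟨f, φ.cocycleMap G 1 g, _, rfl, rfl,
    (ht.comp_left φ.smooth_nebulaMap φ.ev_nebulaMap).congr
      (fun _ _ _ => rfl) fun _ _ => pairValue_cocycleMap φ g⟩

end Corresponds

theorem exists_corresponds (hQ : ∀ q ∈ Q.plots, ContractibleSpace q.domain)
    (a : FamilyCohomology R G 1) : ∃ b : FamilyCohomology Q G 1, Corresponds a b := by
  obtain ⟨f, rfl⟩ := QuotientAddGroup.mk_surjective a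
  obtain ⟨t, ht⟩ := (isCocycle_pairValue f).hasSection_ev hQ
  obtain ⟨F', hF', htrans⟩ := ht.exists_isTransition (isSubduction_ev R) (dSmooth_ev Q)
  exact ⟨_, f, hF'.toCocycle, t, rfl, rfl,
    htrans.congr (fun _ _ _ => rfl) fun _ _ => hF'.pairValue_toCocycle⟩

theorem toCech_cohomologyMap {k : ℕ} (φ : Refinement Q R) (a : FamilyCohomology Q G k) :
    toCech R G k (φ.cohomologyMap G k a) = toCech Q G k a := by
  refine (QuotientAddGroup.eq.2 ?_).symm
  refine AddSubgroup.subset_closure ⟨Q, R, φ, a, ?_⟩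
  exact neg_add_eq_sub _ _

/-- The plot `p` factors smoothly through a member of the generating family `Q`. -/
def FactorsThrough (p : Plot X) (Q : GeneratingFamily X) : Prop :=
  ∃ (q : Q.plots) (f : p.domain → q.1.domain), DSmooth f ∧ ∀ x, q.1.toFun (f x) = p.toFun x

theorem nonempty_refinement (h : ∀ p ∈ R.plots, FactorsThrough p Q) :
    Nonempty (Refinement Q R) := by
  choose i f hf hfp using fun p : R.plots => h p.1 p.2
  exact ⟨⟨i, f, hf, hfp⟩⟩

theorem exists_common_refinement (Q R : GeneratingFamily X) :
    ∃ S : GeneratingFamily X, Nonempty (Refinement Q S) ∧ Nonempty (Refinement R S) := by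
  refine ⟨⟨{p | FactorsThrough p Q ∧ FactorsThrough p R}, fun p x => ?_⟩,
    nonempty_refinement fun _ hp => hp.1, nonempty_refinement fun _ hp => hp.2⟩
  obtain ⟨V, hV, hxV, q, hq, f, hf, hfp⟩ := Q.generating p x
  obtain ⟨W, _, hxW, r, hr, g, hg, hgp⟩ := R.generating p x
  have dSmooth_inclusion {A B : Opens (EuclideanSpace ℝ (Fin p.dim))} (h : A ≤ B) :
      DSmooth fun y : A => (⟨y, h y.2⟩ : B) := fun _ _ hc => hc
  refine ⟨V ⊓ W, inf_le_left.trans hV, ⟨hxV, hxW⟩,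
    ⟨p.dim, V ⊓ W, fun y => p.toFun ⟨y, hV y.2.1⟩,
      p.smooth.comp (dSmooth_inclusion (inf_le_left.trans hV))⟩, ⟨?_, ?_⟩, id, dSmooth_id,
    fun _ => rfl⟩
  · exact ⟨⟨q, hq⟩, fun y => f ⟨y, y.2.1⟩, hf.comp (dSmooth_inclusion inf_le_left),
      fun y => (hfp ⟨y, y.2.1⟩).symm⟩
  · exact ⟨⟨r, hr⟩, fun y => g ⟨y, y.2.2⟩, hg.comp (dSmooth_inclusion inf_le_right),
      fun y => (hgp ⟨y, y.2.2⟩).symm⟩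

theorem Corresponds.toCech_eq {a : FamilyCohomology R G 1} {b : FamilyCohomology Q G 1}
    (h : Corresponds a b) : toCech R G 1 a = toCech Q G 1 b := by
  obtain ⟨S, ⟨φ⟩, ⟨ψ⟩⟩ := exists_common_refinement Q R
  rw [← toCech_cohomologyMap φ b, ← toCech_cohomologyMap ψ a,
    ((Corresponds.refl a).cohomologyMap_right ψ).right_unique (h.cohomologyMap_right φ)]

/-- The homomorphism that sends a class on `R` to the corresponding class on `Q`. -/
def transfer (R : GeneratingFamily X) (h : ∀ a : FamilyCohomology R G 1,
    ∃ b : FamilyCohomology Q G 1, Corresponds a b) :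
    FamilyCohomology R G 1 →+ FamilyCohomology Q G 1 :=
  AddMonoidHom.mk' (fun a => (h a).choose) fun a a' =>
    (h (a + a')).choose_spec.right_unique ((h a).choose_spec.add (h a').choose_spec)

theorem corresponds_transfer (h : ∀ a : FamilyCohomology R G 1,
    ∃ b : FamilyCohomology Q G 1, Corresponds a b) (a : FamilyCohomology R G 1) :
    Corresponds a (transfer R h a) :=
  (h a).choose_spec

end Correspondence

section Colimit

variable {X : Type*} [DiffeologicalSpace X] {Q : GeneratingFamily X} {G : Type*}
  [AddCommGroup G] [DiffeologicalSpace G] [AbelianDiffeologicalGroup G]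

theorem toCech_surjective (h : ∀ (R : GeneratingFamily X) (a : FamilyCohomology R G 1),
    ∃ b : FamilyCohomology Q G 1, Corresponds a b) : Surjective (toCech Q G 1) := by
  classical
  intro z
  obtain ⟨z, rfl⟩ := QuotientAddGroup.mk_surjective z
  induction z using DirectSum.induction_on with
  | zero => exact ⟨0, map_zero _⟩
  | of R a =>
    obtain ⟨b, hb⟩ := h R a
    exact ⟨b, hb.toCech_eq.symm⟩
  | add x y hx hy =>
    obtain ⟨a, ha⟩ := hx
    obtain ⟨b, hb⟩ := hy
    exact ⟨a + b, by rw [map_add, ha, hb]; rfl⟩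

theorem toCech_injective (h : ∀ (R : GeneratingFamily X) (a : FamilyCohomology R G 1),
    ∃ b : FamilyCohomology Q G 1, Corresponds a b) : Injective (toCech Q G 1) := by
  classical
  let T : (⨁ R : GeneratingFamily X, FamilyCohomology R G 1) →+ FamilyCohomology Q G 1 :=
    DirectSum.toAddMonoid fun R => transfer R (h R)
  have T_of (R : GeneratingFamily X) (a : FamilyCohomology R G 1) :
      T (DirectSum.of (fun R : GeneratingFamily X => FamilyCohomology R G 1) R a) =
        transfer R (h R) a :=
    DirectSum.toAddMonoid_of (β := fun R : GeneratingFamily X => FamilyCohomology R G 1)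
      (fun R => transfer R (h R)) R a
  have relations_le_ker : colimitRelations X G 1 ≤ T.ker := by
    refine (AddSubgroup.closure_le _).2 ?_
    rintro _ ⟨R, S, φ, a, rfl⟩
    change T _ = 0
    rw [map_sub, sub_eq_zero]
    exact (T_of S _).trans (((corresponds_transfer (h S) _).right_unique
      ((corresponds_transfer (h R) a).cohomologyMap_left φ)).trans (T_of R a).symm)
  refine LeftInverse.injective (g := QuotientAddGroup.lift _ T relations_le_ker) fun a => ?_
  exact (T_of Q a).trans ((corresponds_transfer (h Q) a).right_unique (.refl a))

theorem toCech_bijective (hQ : ∀ q ∈ Q.plots, ContractibleSpace q.domain) :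
    Bijective (toCech Q G 1) :=
  ⟨toCech_injective fun _ => exists_corresponds hQ,
    toCech_surjective fun _ => exists_corresponds hQ⟩

end Colimit

/-! ### Actions on the trivial bundle over the nebula -/

section Action

variable {X : Type*} [DiffeologicalSpace X] {Q : GeneratingFamily X} {G : Type*}
  [AddCommGroup G]

theorem translate_zero (y : Nebula Q) (g : G) : translate (y, 0) g = (y, g) :=
  Prod.ext rfl (zero_add g)

variable [DiffeologicalSpace G]

namespace NebulaAction

open Classical in
/-- The cocycle of an action, given by `(a, b) · (b, 0) = (a, F a b)` on the fiber product and
extended by zero. -/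
def cocycle (A : NebulaAction Q G) (a b : Nebula Q) : G :=
  if h : ev Q a = ev Q b then (A.act ⟨(⟨(a, b), h⟩, (b, 0)), rfl⟩).2 else 0

theorem act_eq_cocycle_add (A : NebulaAction Q G) {a b : Nebula Q} (h : ev Q a = ev Q b) (g : G) :
    A.act ⟨(⟨(a, b), h⟩, (b, g)), rfl⟩ = (a, A.cocycle a b + g) := by
  have hact := A.act_translate ⟨(a, b), h⟩ (b, 0) rfl g
  simp only [translate_zero] at hact
  rw [hact, cocycle, dif_pos h]
  exact Prod.ext (A.anchor_act ⟨(⟨(a, b), h⟩, (b, 0)), rfl⟩) rfl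

theorem isCocycle_cocycle (A : NebulaAction Q G) : IsCocycle (ev Q) A.cocycle where
  add a b c hab hbc := by
    have hmul := A.mul_act ⟨(a, b), hab⟩ ⟨(b, c), hbc⟩ (c, 0) rfl rfl
    simp only [A.act_eq_cocycle_add hbc, A.act_eq_cocycle_add hab] at hmul
    simpa using (congrArg Prod.snd (hmul.trans (A.act_eq_cocycle_add (hab.trans hbc) 0))).symm
  smooth n w hw hmem := by
    have hcocycle : (fun r => A.cocycle (w r).1 (w r).2) =
        fun r => (A.act ⟨(⟨w r, hmem r⟩, ((w r).2, 0)), rfl⟩).2 :=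
      funext fun r => dif_pos (hmem r)
    rw [hcocycle]
    exact (A.smooth_act n (fun r => ⟨(⟨w r, hmem r⟩, ((w r).2, 0)), rfl⟩)
      ⟨hw, hw.2, isPlot_const⟩).2

end NebulaAction

variable [AbelianDiffeologicalGroup G]

/-- The action `(a, b) · (b, g) = (a, F a b + g)` defined by a cocycle. -/
def IsCocycle.nebulaAction {F : Nebula Q → Nebula Q → G} (hF : IsCocycle (ev Q) F) :
    NebulaAction Q G where
  act p := (p.1.1.1.1, F p.1.1.1.1 p.1.1.1.2 + p.1.2.2)
  smooth_anchor := dSmooth_fst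
  smooth_act n p hp := ⟨hp.1.1, AbelianDiffeologicalGroup.smooth_add n
    (fun r => (F (p r).1.1.1.1 (p r).1.1.1.2, (p r).1.2.2))
    ⟨hF.smooth (p := fun r => (p r).1.1.1) hp.1 fun r => (p r).1.1.2, hp.2.2⟩⟩
  anchor_act _ := rfl
  mul_act := by
    rintro ⟨⟨a, b⟩, hab⟩ ⟨⟨b', c⟩, hbc⟩ ⟨c', g⟩ (rfl : b = b') (rfl : c = c')
    refine Prod.ext rfl ?_
    change F a b + (F b c + g) = F a c + g
    rw [hF.add hab hbc, add_assoc]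
  unit_act z := Prod.ext rfl (by
    change F z.1 z.1 + z.2 = z.2
    rw [hF.self_eq_zero, zero_add])
  act_translate _ _ _ _ := Prod.ext rfl (add_assoc _ _ _).symm

/-- The action defined by a Čech `1`-cocycle. -/
def cocycleAction (f : cocycles Q G 1) : NebulaAction Q G :=
  (isCocycle_pairValue f).nebulaAction

theorem cocycleAction_act (f : cocycles Q G 1) {a b : Nebula Q} (h : ev Q a = ev Q b) (g : G) :
    (cocycleAction f).act ⟨(⟨(a, b), h⟩, (b, g)), rfl⟩ = (a, pairValue f.1 a b + g) := rfl

theorem mk_eq_mk_of_cocycleAction_equiv {f g : cocycles Q G 1}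
    (h : cocycleAction f ≈ cocycleAction g) :
    (QuotientAddGroup.mk f : FamilyCohomology Q G 1) = QuotientAddGroup.mk g := by
  obtain ⟨Φ, hΦ, -, htranslate⟩ := h
  have Φ_snd (y : Nebula Q) (c : G) : (Φ (y, c)).2 = (Φ (y, 0)).2 + c := by
    rw [← translate_zero y c, htranslate]
    rfl
  refine mk_eq_mk_iff.2 ⟨fun y => -(Φ (y, 0)).2, fun n p hp => AbelianDiffeologicalGroup.smooth_neg
    n _ (hΦ.smooth n (fun r => (p r, 0)) ⟨hp, isPlot_const⟩).2, fun a b hab => ?_⟩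
  have hact : (Φ (a, pairValue f.1 a b + 0)).2 = pairValue g.1 a b + (Φ (b, 0)).2 :=
    congrArg Prod.snd (hΦ.map_act ⟨(a, b), hab⟩ (b, 0) rfl)
  rw [add_zero, Φ_snd] at hact
  rw [← sub_eq_iff_eq_add.2 hact]
  simp only [sub_neg_eq_add]
  abel

theorem cocycleAction_equiv_of_mk_eq_mk {f g : cocycles Q G 1}
    (h : (QuotientAddGroup.mk f : FamilyCohomology Q G 1) = QuotientAddGroup.mk g) :
    cocycleAction f ≈ cocycleAction g := by
  obtain ⟨d, hd, hfg⟩ := mk_eq_mk_iff.1 h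
  have hdfst : DSmoothOn (fun z : Nebula Q × G => d z.1) univ :=
    dSmoothOn_univ.2 (hd.comp dSmooth_fst)
  have hsnd : DSmoothOn (Prod.snd : Nebula Q × G → G) univ := dSmoothOn_univ.2 dSmooth_snd
  have hfst : DSmoothOn (Prod.fst : Nebula Q × G → Nebula Q) univ := dSmoothOn_univ.2 dSmooth_fst
  refine ⟨⟨fun z => (z.1, z.2 - d z.1), fun z => (z.1, z.2 + d z.1), fun z => by simp,
    fun z => by simp⟩, ⟨dSmoothOn_univ.1 (hfst.prodMk (hsnd.sub hdfst)), fun _ => rfl, ?_⟩,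
    dSmoothOn_univ.1 (hfst.prodMk (hsnd.add hdfst)),
    fun z c => Prod.ext rfl (add_sub_right_comm _ _ _)⟩
  rintro ⟨⟨a, b⟩, hab⟩ ⟨b', c⟩ (rfl : b = b')
  refine Prod.ext rfl ?_
  change pairValue f.1 a b + c - d a = pairValue g.1 a b + (c - d b)
  rw [hfg a b hab]
  abel

theorem exists_cocycleAction_equiv (A : NebulaAction Q G) :
    ∃ f : cocycles Q G 1, cocycleAction f ≈ A := by
  have hcocycle := A.isCocycle_cocycle
  refine ⟨hcocycle.toCocycle, Equiv.refl _, ⟨dSmooth_id, fun _ => rfl, ?_⟩, dSmooth_id,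
    fun _ _ => rfl⟩
  rintro ⟨⟨a, b⟩, hab⟩ ⟨b', g⟩ (rfl : b = b')
  change (cocycleAction hcocycle.toCocycle).act ⟨(⟨(a, b), hab⟩, (b, g)), rfl⟩ =
    A.act ⟨(⟨(a, b), hab⟩, (b, g)), rfl⟩
  rw [cocycleAction_act, A.act_eq_cocycle_add hab, hcocycle.pairValue_toCocycle hab]

variable (Q G) in
/-- The correspondence between cohomology classes of degree one and isomorphism classes of actions,
induced by `cocycleAction`. -/
def cohomologyEquivActionClasses : FamilyCohomology Q G 1 ≃ NebulaActionClasses Q G :=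
  Equiv.ofBijective
    (Quotient.lift (fun f => (Quotient.mk _ (cocycleAction f) : NebulaActionClasses Q G))
      fun _ _ hfg => Quotient.sound (cocycleAction_equiv_of_mk_eq_mk (Quotient.sound hfg)))
    ⟨fun a b => by
      obtain ⟨f, rfl⟩ := QuotientAddGroup.mk_surjective a
      obtain ⟨g, rfl⟩ := QuotientAddGroup.mk_surjective b
      exact fun h => mk_eq_mk_of_cocycleAction_equiv (Quotient.exact h), fun c => by
      obtain ⟨A, rfl⟩ := Quotient.exists_rep c
      obtain ⟨f, hf⟩ := exists_cocycleAction_equiv A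
      exact ⟨QuotientAddGroup.mk f, Quotient.sound hf⟩⟩

theorem cohomologyEquivActionClasses_mk (f : cocycles Q G 1) :
    cohomologyEquivActionClasses Q G (QuotientAddGroup.mk f) = Quotient.mk _ (cocycleAction f) :=
  rfl

end Action

end

end DiffCech

theorem corollaryc {X : Type*} {G : Type*} [DiffeologicalSpace X] [AddCommGroup G]
    [DiffeologicalSpace G] [DiffCech.AbelianDiffeologicalGroup G]
    (Q : DiffCech.GeneratingFamily X) (hQ : ∀ q ∈ Q.plots, ContractibleSpace q.domain) :
    Function.Bijective (DiffCech.toCech Q G 1) ∧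
    ∃ e : DiffCech.CechCohomology X G 1 ≃ DiffCech.NebulaActionClasses Q G,
      ∀ f : DiffCech.cocycles Q G 1, ∃ A : DiffCech.NebulaAction Q G,
        (∀ (y₁ y₂ : DiffCech.Nebula Q) (h : DiffCech.ev Q y₁ = DiffCech.ev Q y₂) (g : G),
          A.act ⟨(⟨(y₁, y₂), h⟩, (y₂, g)), rfl⟩ =
            (y₁, f.1.1 (DiffCech.NebulaPower.pair y₁ y₂ h) + g)) ∧
        e (DiffCech.toCech Q G 1 (QuotientAddGroup.mk f)) = Quotient.mk _ A := by
  have hbij := DiffCech.toCech_bijective (G := G) hQ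
  refine ⟨hbij, (Equiv.ofBijective _ hbij).symm.trans (DiffCech.cohomologyEquivActionClasses Q G),
    fun f => ⟨DiffCech.cocycleAction f, fun y₁ y₂ h g => ?_, ?_⟩⟩
  · rw [DiffCech.cocycleAction_act, DiffCech.pairValue_of_eq]
  · rw [Equiv.trans_apply, Equiv.ofBijective_symm_apply_apply,
      DiffCech.cohomologyEquivActionClasses_mk]
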